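/- Let $G=(V,E)$ be an undirected graph (of any cardinality, multiple edges and self-loops allowed) with edge lengths $\ell_e>0$, edge weights $a_e>0$, vertex weights $\mathcal V(v)>0$ and a specified set $\partial\mathcal G\subset V$ of boundary vertices. Its geometric realization $\mathcal G$, in which each edge $e$ is an interval of length $\ell_e$, carries the path metric. Put $V^\circ=V\setminus\partial\mathcal G$, call a function on $\mathcal G$ edgewise linear if it is continuous and affine on each edge interior, and for such $g$ and $v\in V$ put $$(\Delta g)(v)=\mathcal V(v)^{-1}\sum_{e\sim\{u,v\}}a_e\,\frac{g(v)-g(u)}{\ell_e}$$ when the sum converges unconditionally. For $0<T\le\infty$ write $I_T=[0,T]$ if $T<\infty$ and $I_\infty=[0,\infty)$. Given $f\colon V^\circ\to\mathbb R$, a solution of the Dirichlet initial value problem on $\mathcal G\times I_T$ with initial value $f$ is a continuous $u\colon\mathcal G\times I_T\to\mathbb R$ such that $u(\cdot,t)$ is edgewise linear for each $t\in I_T$; for all $x\in V^\circ$ and $0<t<T$ both $u_t(x,t)$ and $\Delta u(x,t)$ exist and $u_t(x,t)=-\Delta u(x,t)$; $u(x,0)=f(x)$ for $x\in V^\circ$;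 and $u(x,t)=0$ for $x\in\partial\mathcal G$, $t\in I_T$. For $v\in V$ let $L(v)=\mathcal V(v)^{-1}\sum_{e\ni v}a_e/\ell_e\in[0,\infty]$, the sum being over the edges at $v$ that are not self-loops, and for $v\in V^\circ$ let $L_j(v)$ be the supremum of $L(u)$ over all $u$ that are joined to $v$ by a path of length at most $j$ (number of edges) all of whose vertices lie in $V^\circ$. Suppose that there is a constant $C$ such that for each fixed $v\in V^\circ$ $$L_j(v)\le Cj\quad\text{for all sufficiently large } j,$$ or that there is a constant $C$ such that for each fixed $v\in V^\circ$ $$L_0(v)L_1(v)\cdots L_j(v)\le (Cj)^j\quad\text{for all sufficiently large } j.$$ **Theorem.** For every $T\in(0,\infty]$ and every $f\colon V^\circ\to\mathbb R$, the Dirichlet initial value problem on $\mathcal G\times I_T$ with initial value $f$ has at most one solution $u(x,t)$ that is bounded in $x$ for each fixed $t\in I_T$. If moreover $G$ is locally finite (each vertex is incident with only finitely many edges) and $f$ is bounded, it has exactly one such solution. -/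

import Mathlib

open scoped ENNReal NNReal Topology

/-- A graph (multiple edges and self-loops allowed, no cardinality restriction) with edge lengths
`ℓ_e`, edge weights `a_e`, vertex measure `𝒱` and a specified set of boundary vertices.  The order
of the two endpoints `src e`, `tgt e` of an edge only serves to parametrize the edge by
`[0, ℓ_e]`; the graph is undirected. -/
structure CalcGraph (V E : Type*) where
  src : E → V
  tgt : E → V
  len : E → ℝ
  len_pos : ∀ e, 0 < len e
  wt : E → ℝ
  wt_pos : ∀ e, 0 < wt e
  vol : V → ℝ
  vol_pos : ∀ v, 0 < vol v
  boundary : Set V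

namespace CalcGraph

variable {V E : Type*} (G : CalcGraph V E)

/-- The interior vertices. -/
def interiorV : Set V := G.boundaryᶜ

/-- `e` has the endpoints `u` and `v`. -/
def Joins (e : E) (u v : V) : Prop :=
  (G.src e = u ∧ G.tgt e = v) ∨ (G.src e = v ∧ G.tgt e = u)

/-- `e` has `v` as an endpoint. -/
def Incident (e : E) (v : V) : Prop := G.src e = v ∨ G.tgt e = v

/-- `e` is a self-loop. -/
def IsLoop (e : E) : Prop := G.src e = G.tgt e

open Classical in
/-- The endpoint of `e` other than `v`, for `e` incident with `v` (it is `v` if `e` is a loop). -/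
noncomputable def other (e : E) (v : V) : V := if G.src e = v then G.tgt e else G.src e

/-- Every vertex is incident with only finitely many edges. -/
def LocallyFinite : Prop := ∀ v, {e | G.Incident e v}.Finite

/-! ### The geometric realization -/

/-- The points of the geometric realization: the vertices and the points in the edge interiors,
where `inner e s` is the point of `e` at distance `s` along `e` from `src e`. -/
inductive Point : Type _
  | vertex (v : V) : Point
  | inner (e : E) (s : ℝ) (hs : s ∈ Set.Ioo 0 (G.len e)) : Point

open Classical in
/-- The parametrization of the closed edge `e` by `s ∈ [0, ℓ_e]`, from `src e` to `tgt e`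
(constant outside `[0, ℓ_e]`). -/
noncomputable def pt (e : E) (s : ℝ) : G.Point :=
  if hs : s ∈ Set.Ioo 0 (G.len e) then Point.inner e s hs
  else if s ≤ 0 then Point.vertex (G.src e) else Point.vertex (G.tgt e)

/-- `HasPath p q r`: there is a path of length `r` from `p` to `q`, composed of finitely many
segments each of which lies in one closed edge. -/
inductive HasPath : G.Point → G.Point → ℝ → Prop
  | refl (p : G.Point) : HasPath p p 0
  | step {q : G.Point} {r : ℝ} (e : E) (s t : ℝ) (hs : s ∈ Set.Icc 0 (G.len e))
      (ht : t ∈ Set.Icc 0 (G.len e)) (h : HasPath (G.pt e t) q r) :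
      HasPath (G.pt e s) q (|s - t| + r)

variable {G} in
theorem HasPath.trans {p q q' : G.Point} {r r' : ℝ} (h : G.HasPath p q r)
    (h' : G.HasPath q q' r') : G.HasPath p q' (r + r') := by
  induction h with
  | refl p => simpa using h'
  | step e s t hs ht _ ih => rw [add_assoc]; exact .step e s t hs ht (ih h')

variable {G} in
theorem HasPath.symm {p q : G.Point} {r : ℝ} (h : G.HasPath p q r) : G.HasPath q p r := by
  induction h with
  | refl p => exact .refl p
  | step e s t hs ht _ ih =>
    have h1 := ih.trans (HasPath.step e t s ht hs (.refl _))
    rwa [add_zero, abs_sub_comm, add_comm] at h1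

variable {G} in
theorem HasPath.nonneg {p q : G.Point} {r : ℝ} (h : G.HasPath p q r) : 0 ≤ r := by
  induction h with
  | refl p => exact le_rfl
  | step e s t hs ht _ ih => positivity

/-- The path metric: the distance of two points is the infimum of the lengths of the paths that
join them, and `∞` if there is no such path. -/
noncomputable def pathDist (p q : G.Point) : ℝ≥0∞ :=
  ⨅ (r : ℝ) (_ : G.HasPath p q r), ENNReal.ofReal r

variable {G} in
theorem pathDist_le {p q : G.Point} {r : ℝ} (h : G.HasPath p q r) :
    G.pathDist p q ≤ ENNReal.ofReal r := iInf₂_le r h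

noncomputable instance : PseudoEMetricSpace G.Point where
  edist p q := G.pathDist p q
  edist_self p := le_antisymm (by simpa using pathDist_le (HasPath.refl p)) zero_le
  edist_comm p q := le_antisymm
    (le_iInf₂ fun r h => pathDist_le h.symm) (le_iInf₂ fun r h => pathDist_le h.symm)
  edist_triangle p q q' := by
    refine ENNReal.le_of_forall_pos_le_add fun ε hε hfin => ?_
    have key : ∀ {a b : G.Point}, G.pathDist a b < ∞ → ∃ r, G.HasPath a b r ∧
        ENNReal.ofReal r < G.pathDist a b + ((ε / 2 : ℝ≥0) : ℝ≥0∞) := by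
      intro a b hab
      have h1 : G.pathDist a b < G.pathDist a b + ((ε / 2 : ℝ≥0) : ℝ≥0∞) :=
        ENNReal.lt_add_right hab.ne (by simpa using hε.ne')
      obtain ⟨r, h, hr⟩ := by simpa only [iInf_lt_iff] using iInf_lt_iff.1 h1
      exact ⟨r, h, hr⟩
    obtain ⟨r, h, hr⟩ := key (lt_of_le_of_lt le_self_add hfin)
    obtain ⟨r', h', hr'⟩ := key (lt_of_le_of_lt le_add_self hfin)
    calc G.pathDist p q' ≤ ENNReal.ofReal (r + r') := pathDist_le (h.trans h')
      _ = ENNReal.ofReal r + ENNReal.ofReal r' := ENNReal.ofReal_add h.nonneg h'.nonneg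
      _ ≤ (G.pathDist p q + ((ε / 2 : ℝ≥0) : ℝ≥0∞)) +
          (G.pathDist q q' + ((ε / 2 : ℝ≥0) : ℝ≥0∞)) := add_le_add hr.le hr'.le
      _ = G.pathDist p q + G.pathDist q q' + ε := by
        rw [add_add_add_comm, ← ENNReal.coe_add, add_halves]

/-- A function on the geometric realization is edgewise linear if it is continuous and its
restriction to each edge interior is linear (i.e. affine in the arc length). -/
def EdgewiseLinear (f : G.Point → ℝ) : Prop :=
  Continuous f ∧ ∀ e, ∃ a b : ℝ, ∀ s ∈ Set.Ioo 0 (G.len e), f (G.pt e s) = a + b * s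

/-- The Laplacian of the (edgewise linear) function `f` exists at the vertex `v` and equals `d`:
`d = 𝒱(v)⁻¹ ∑_{e ∼ {u, v}} a_e (f(v) - f(u)) / ℓ_e`. -/
def HasLaplacianAt (f : G.Point → ℝ) (v : V) (d : ℝ) : Prop :=
  ∃ S : ℝ, HasSum (fun e : {e // G.Incident e v} =>
      G.wt e * ((f (.vertex v) - f (.vertex (G.other e v))) / G.len e)) S ∧
    d = (G.vol v)⁻¹ * S

/-! ### The Dirichlet initial value problem -/

/-- The time interval `[0, T]`, which is `[0, ∞)` for `T = ∞`. -/
def timeInterval (T : EReal) : Set ℝ := {t | 0 ≤ t ∧ (t : EReal) ≤ T}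

/-- `u` satisfies the heat equation on `𝒢 × [0, T]`. -/
structure IsHeatSolution (T : EReal) (u : G.Point → ℝ → ℝ) : Prop where
  continuousOn : ContinuousOn (fun p : G.Point × ℝ => u p.1 p.2) (Set.univ ×ˢ timeInterval T)
  edgewiseLinear : ∀ t ∈ timeInterval T, G.EdgewiseLinear fun x => u x t
  heat : ∀ v ∈ G.interiorV, ∀ t : ℝ, 0 < t → (t : EReal) < T →
    ∃ d : ℝ, G.HasLaplacianAt (fun x => u x t) v d ∧ HasDerivAt (u (.vertex v)) (-d) t

/-- `u` solves the Dirichlet initial value problem on `𝒢 × [0, T]` with initial value `f`. -/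
structure IsDirichletSolution (T : EReal) (f : G.interiorV → ℝ) (u : G.Point → ℝ → ℝ) : Prop
    extends G.IsHeatSolution T u where
  initial : ∀ v : G.interiorV, u (.vertex v) 0 = f v
  dirichlet : ∀ v ∈ G.boundary, ∀ t ∈ timeInterval T, u (.vertex v) t = 0

/-- `u(x, t)` is bounded in `x` for any fixed `t ∈ [0, T]`. -/
def BoundedInSpace (T : EReal) (u : G.Point → ℝ → ℝ) : Prop :=
  ∀ t ∈ timeInterval T, ∃ B : ℝ, ∀ x, |u x t| ≤ B

/-! ### The growth quantities -/

/-- `L(v) = 𝒱(v)⁻¹ ∑_{e ∋ v} a_e / ℓ_e`, self-loops omitted, as an extended real number. -/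
noncomputable def L (v : V) : ℝ≥0∞ :=
  (ENNReal.ofReal (G.vol v))⁻¹ *
    ∑' e : {e // G.Incident e v ∧ ¬ G.IsLoop e}, ENNReal.ofReal (G.wt e / G.len e)

/-- `InteriorPath v u n`: a path of length `n` from `v` to `u` all of whose vertices are
interior. -/
inductive InteriorPath : V → V → ℕ → Prop
  | nil {v : V} (hv : v ∈ G.interiorV) : InteriorPath v v 0
  | cons {v w u : V} {n : ℕ} (hv : v ∈ G.interiorV) (e : E) (he : G.Joins e v w)
      (h : InteriorPath w u n) : InteriorPath v u (n + 1)

/-- `L_j(v)`: the supremum of `L` over the vertices that are joined to `v` by a path of length at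
most `j` through interior vertices. -/
noncomputable def Lsup (j : ℕ) (v : V) : ℝ≥0∞ :=
  ⨆ u ∈ {u | ∃ n ≤ j, G.InteriorPath v u n}, G.L u

end CalcGraph

/-! Uniqueness. On the vertices, the difference `u` of two solutions satisfies `|u'| ≤ P|u|`, where
`P = majorantOp` is a positive operator dominating the Laplacian. A step of `P` costs at most twice
`L` and moves to a neighbour, so `Pⁿ1(v) ≤ 2ⁿ L₀(v)⋯L_{n-1}(v)` (`iterate_majorantOp_one_le`).
Either growth condition bounds this product by `K Dⁿ n!` with `D` independent of `v`, so `A_s =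
exp(sP)1` (`expMajorant`) is finite everywhere for a common small `s = 2τ`
(`exists_expMajorant_ne_top`).

If `|u| ≤ M` at the initial time and `|u| ≤ B A_τ` on a time interval of length at most `τ`, then
`N` Picard steps bound `|u|` by `M A_τ` plus `B` times the tail from `N` on of the series of
`A_{2τ}`. Letting `N → ∞` removes `B` (`enorm_le_mul_expMajorant`). The inequality is invariant
under time reversal, so this also works backwards.

The hypothesis gives a bound in space at each single time only, with no uniformity in time. Baire's
theorem supplies the missing domination. On some portion of the closed set of bad times `u` is
uniformly bounded, and the estimate carries this bound across the complementary gaps, so the times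
of that portion are not bad after all (`HeatInequality.locallyDominated`). Vanishing initial values
then propagate in steps of length `τ`.

Existence. Local finiteness makes the vertex equations finite sums. Picard iteration on the integral
equation, starting from `0`, is monotone and bounded by the constant supersolution, and its limit is
a solution (`exists_heat_solution_of_nonneg`). Signed data are split into positive and negative
parts. Linear interpolation along edges gives the function on the realization, jointly continuous by
a modulus that is uniform over bounded vertex functions (`continuous_interp`). -/

/-! ### The positive majorant of a Laplacian and its exponential -/

/-- The positive operator `g ↦ ∑ₑ c(v, e) (g(nbr(v, e)) + g(v))`, which dominates the Laplacian
`g ↦ ∑ₑ c(v, e) (g(nbr(v, e)) - g(v))`. -/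
noncomputable def majorantOp {V E : Type*} (c : V → E → ℝ≥0∞) (nbr : V → E → V)
    (g : V → ℝ≥0∞) (v : V) : ℝ≥0∞ :=
  ∑' e, c v e * (g (nbr v e) + g v)

/-- The coefficient `sⁿ / n!` of the exponential series. -/
noncomputable def expCoeff (s : ℝ≥0) (n : ℕ) : ℝ≥0 := s ^ n / n.factorial

/-- The value at `1` of the formal exponential of `s` times the operator `majorantOp c nbr`. -/
noncomputable def expMajorant {V E : Type*} (c : V → E → ℝ≥0∞) (nbr : V → E → V) (s : ℝ≥0)
    (v : V) : ℝ≥0∞ :=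
  ∑' n, (expCoeff s n : ℝ≥0∞) * (majorantOp c nbr)^[n] 1 v

/-- After clearing factorials, the left side is a single term of the binomial expansion of `(s + t)
^ (m + n)`. This is what bounds a remainder at time `t` by a tail of the series at time `s + t`. -/
theorem expCoeff_mul_expCoeff_le (s t : ℝ≥0) (m n : ℕ) :
    expCoeff s m * expCoeff t n ≤ expCoeff (s + t) (m + n) := by
  unfold expCoeff
  rw [div_mul_div_comm, div_le_div_iff₀ (by positivity) (by positivity)]
  have h1 : s ^ m * t ^ n * ((m + n).choose m : ℝ≥0) ≤ (s + t) ^ (m + n) := by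
    rw [add_pow]
    have := Finset.single_le_sum
      (f := fun k => s ^ k * t ^ (m + n - k) * ((m + n).choose k : ℝ≥0))
      (fun _ _ => zero_le) (Finset.mem_range.2 (show m < m + n + 1 by omega))
    simpa using this
  have h2 : ((m + n).factorial : ℝ≥0) = (m + n).choose m * m.factorial * n.factorial := by
    have := Nat.choose_mul_factorial_mul_factorial (Nat.le_add_right m n)
    rw [Nat.add_sub_cancel_left] at this
    exact_mod_cast this.symm
  rw [h2]
  calc s ^ m * t ^ n * ((m + n).choose m * m.factorial * n.factorial)
      = s ^ m * t ^ n * ((m + n).choose m : ℝ≥0) * (m.factorial * n.factorial) := by ring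
    _ ≤ _ := by gcongr

theorem expCoeff_mono {s t : ℝ≥0} (h : s ≤ t) (n : ℕ) : expCoeff s n ≤ expCoeff t n := by
  unfold expCoeff; gcongr

section Majorant

variable {V E : Type*} (c : V → E → ℝ≥0∞) (nbr : V → E → V)

theorem majorantOp_mono : Monotone (majorantOp c nbr) := fun g h hgh v =>
  ENNReal.tsum_le_tsum fun e => by gcongr <;> apply hgh

theorem majorantOp_const_mul (a : ℝ≥0∞) (g : V → ℝ≥0∞) :
    majorantOp c nbr (fun v => a * g v) = fun v => a * majorantOp c nbr g v := by
  ext v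
  simp only [majorantOp, ← ENNReal.tsum_mul_left]
  exact tsum_congr fun e => by ring

theorem majorantOp_tsum {ι : Type*} (g : ι → V → ℝ≥0∞) :
    majorantOp c nbr (fun v => ∑' i, g i v) = fun v => ∑' i, majorantOp c nbr (g i) v := by
  ext v
  simp only [majorantOp]
  rw [ENNReal.tsum_comm]
  exact tsum_congr fun e => by rw [← ENNReal.tsum_add, ← ENNReal.tsum_mul_left]

theorem majorantOp_sum {ι : Type*} (s : Finset ι) (g : ι → V → ℝ≥0∞) :
    majorantOp c nbr (fun v => ∑ i ∈ s, g i v) = fun v => ∑ i ∈ s, majorantOp c nbr (g i) v := by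
  have h := majorantOp_tsum c nbr (fun i : s => g i)
  simp only [tsum_fintype] at h
  have h1 : (fun v => ∑ i : s, g i v) = fun v => ∑ i ∈ s, g i v :=
    funext fun v => Finset.sum_coe_sort s (fun i => g i v)
  rw [h1] at h
  rw [h]
  exact funext fun v => Finset.sum_coe_sort s (fun i => majorantOp c nbr (g i) v)

theorem iterate_majorantOp_expMajorant (s : ℝ≥0) (N : ℕ) :
    (majorantOp c nbr)^[N] (expMajorant c nbr s) =
      fun v => ∑' n, (expCoeff s n : ℝ≥0∞) * (majorantOp c nbr)^[N + n] 1 v := by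
  induction N with
  | zero => simp only [Function.iterate_zero, id, zero_add]; rfl
  | succ N ih =>
    rw [Function.iterate_succ_apply', ih, majorantOp_tsum]
    simp only [majorantOp_const_mul, ← Function.iterate_succ_apply', Nat.succ_eq_add_one,
      Nat.add_right_comm]

/-- The remainder of the exponential series. -/
theorem expCoeff_mul_iterate_expMajorant_le (s t : ℝ≥0) (N : ℕ) (v : V) :
    (expCoeff s N : ℝ≥0∞) * (majorantOp c nbr)^[N] (expMajorant c nbr t) v ≤
      ∑' n, (expCoeff (s + t) (n + N) : ℝ≥0∞) * (majorantOp c nbr)^[n + N] 1 v := by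
  rw [iterate_majorantOp_expMajorant, ← ENNReal.tsum_mul_left]
  refine ENNReal.tsum_le_tsum fun n => ?_
  rw [← mul_assoc, add_comm n N]
  gcongr
  exact_mod_cast expCoeff_mul_expCoeff_le s t N n

theorem one_le_expMajorant (s : ℝ≥0) (v : V) : 1 ≤ expMajorant c nbr s v := by
  refine le_trans ?_ (ENNReal.le_tsum 0)
  simp [expCoeff]

variable {c nbr} in
theorem tendsto_remainder {t : ℝ≥0} {v : V} (h : expMajorant c nbr t v ≠ ∞) :
    Filter.Tendsto (fun N => ∑' n, (expCoeff t (n + N) : ℝ≥0∞) * (majorantOp c nbr)^[n + N] 1 v)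
      Filter.atTop (𝓝 0) :=
  ENNReal.tendsto_sum_nat_add (fun n => (expCoeff t n : ℝ≥0∞) * (majorantOp c nbr)^[n] 1 v) h

variable {c nbr} in
theorem iterate_majorantOp_one_ne_top {t : ℝ≥0} (ht : 0 < t) {v : V}
    (h : expMajorant c nbr t v ≠ ∞) (n : ℕ) : (majorantOp c nbr)^[n] 1 v ≠ ∞ := by
  have h1 := ENNReal.ne_top_of_tsum_ne_top h n
  intro h2
  rw [h2, ENNReal.mul_top] at h1
  · exact h1 rfl
  · have : expCoeff t n ≠ 0 := by unfold expCoeff; positivity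
    exact_mod_cast this

variable {c nbr} in
theorem iterate_majorantOp_expMajorant_ne_top {t : ℝ≥0} (ht : 0 < t) {v : V}
    (h : expMajorant c nbr (t + t) v ≠ ∞) (n : ℕ) :
    (majorantOp c nbr)^[n] (expMajorant c nbr t) v ≠ ∞ := by
  have h1 : (expCoeff t n : ℝ≥0∞) * (majorantOp c nbr)^[n] (expMajorant c nbr t) v ≠ ∞ := by
    refine ne_top_of_le_ne_top h ((expCoeff_mul_iterate_expMajorant_le c nbr t t n v).trans ?_)
    exact ENNReal.tsum_comp_le_tsum_of_injective (add_left_injective n)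
      (fun n => (expCoeff (t + t) n : ℝ≥0∞) * (majorantOp c nbr)^[n] 1 v)
  intro h2
  rw [h2, ENNReal.mul_top] at h1
  · exact h1 rfl
  · have : expCoeff t n ≠ 0 := by unfold expCoeff; positivity
    exact_mod_cast this

end Majorant

/-! ### A priori estimate by Picard iteration -/

/-- Both `φ - x` and `φ + x` are nondecreasing. No integrability of the derivative of `x` is needed,
so the Picard step can dispense with an integral equation for `u`. -/
theorem abs_le_of_abs_deriv_le {x φ φ' : ℝ → ℝ} {a b : ℝ} (hx : ContinuousOn x (Set.Icc a b))
    (hφ : ∀ t, HasDerivAt φ (φ' t) t)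
    (hd : ∀ t ∈ Set.Ioo a b, ∃ d, HasDerivAt x d t ∧ |d| ≤ φ' t) (h0 : |x a| ≤ φ a)
    {t : ℝ} (ht : t ∈ Set.Icc a b) : |x t| ≤ φ t := by
  have hφc : ContinuousOn φ (Set.Icc a b) := fun t _ => (hφ t).continuousAt.continuousWithinAt
  have ha : a ∈ Set.Icc a b := ⟨le_rfl, ht.1.trans ht.2⟩
  have key : ∀ y : ℝ → ℝ, ContinuousOn y (Set.Icc a b) →
      (∀ t ∈ Set.Ioo a b, ∃ d, HasDerivAt y d t ∧ |d| ≤ φ' t) → |y a| ≤ φ a → y t ≤ φ t := by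
    intro y hy hyd hya
    have hm : MonotoneOn (fun t => φ t - y t) (Set.Icc a b) := by
      refine monotoneOn_of_deriv_nonneg (convex_Icc a b) (hφc.sub hy) ?_ ?_ <;>
        rw [interior_Icc] <;> intro s hs <;> obtain ⟨d, h1, h2⟩ := hyd s hs
      · exact ((hφ s).sub h1).differentiableAt.differentiableWithinAt
      · have h3 : deriv (fun t => φ t - y t) s = φ' s - d := ((hφ s).sub h1).deriv
        rw [h3]
        linarith [le_abs_self d]
    have := hm ha ht ht.1
    simp only at this
    linarith [le_abs_self (y a)]
  refine abs_le'.2 ⟨key x hx hd h0, key (fun t => -x t) hx.neg (fun s hs => ?_) (by simpa using h0)⟩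
  obtain ⟨d, h1, h2⟩ := hd s hs
  exact ⟨-d, h1.neg, by simpa using h2⟩

theorem hasDerivAt_sum_expCoeff (a : ℝ) (m : ℝ) (r : ℕ → ℝ) (N : ℕ) (t : ℝ) :
    HasDerivAt (fun t => m + ∑ n ∈ Finset.range N, (t - a) ^ (n + 1) / (n + 1).factorial * r n)
      (∑ n ∈ Finset.range N, (t - a) ^ n / n.factorial * r n) t := by
  refine (HasDerivAt.fun_sum fun n _ => ?_).const_add m
  have h1 := ((((hasDerivAt_id t).sub_const a).pow (n + 1)).div_const
    ((n + 1).factorial : ℝ)).mul_const (r n)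
  refine h1.congr_deriv ?_
  rw [Nat.factorial_succ]
  have : (n.factorial : ℝ) ≠ 0 := by positivity
  have : (n + 1 : ℝ) ≠ 0 := by positivity
  push_cast
  simp only [id, mul_one]
  field_simp

theorem coe_expCoeff_eq_ofReal {a t : ℝ} (h : a ≤ t) (n : ℕ) :
    (expCoeff (t - a).toNNReal n : ℝ≥0∞) = ENNReal.ofReal ((t - a) ^ n / n.factorial) := by
  rw [ENNReal.ofReal, Real.toNNReal_div (pow_nonneg (sub_nonneg.2 h) n),
    Real.toNNReal_pow (sub_nonneg.2 h), Real.toNNReal_natCast]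
  rfl

/-- One Picard step for the differential inequality `|u'| ≤ P|u|`. -/
theorem picard_step {V E : Type*} {c : V → E → ℝ≥0∞} {nbr : V → E → V} {u : V → ℝ → ℝ} {a b : ℝ}
    {M : ℝ≥0} (hc : ∀ v, ContinuousOn (u v) (Set.Icc a b))
    (hd : ∀ v, ∀ t ∈ Set.Ioo a b, ∃ d, HasDerivAt (u v) d t ∧
      ‖d‖ₑ ≤ majorantOp c nbr (fun w => ‖u w t‖ₑ) v)
    (h0 : ∀ v, ‖u v a‖ₑ ≤ M) {N : ℕ} {g : ℕ → V → ℝ≥0∞}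
    (hg : ∀ n v, majorantOp c nbr (g n) v ≠ ∞)
    (hu : ∀ v, ∀ t ∈ Set.Icc a b, ‖u v t‖ₑ ≤
      ∑ n ∈ Finset.range N, (expCoeff (t - a).toNNReal n : ℝ≥0∞) * g n v)
    (v : V) {t : ℝ} (ht : t ∈ Set.Icc a b) :
    ‖u v t‖ₑ ≤ M + ∑ n ∈ Finset.range N,
      (expCoeff (t - a).toNNReal (n + 1) : ℝ≥0∞) * majorantOp c nbr (g n) v := by
  set r : ℕ → ℝ := fun n => (majorantOp c nbr (g n) v).toReal with hr
  have hr0 : ∀ n, 0 ≤ r n := fun n => ENNReal.toReal_nonneg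
  have hcoe : ∀ n, majorantOp c nbr (g n) v = ENNReal.ofReal (r n) := fun n =>
    (ENNReal.ofReal_toReal (hg n v)).symm
  have main : |u v t| ≤ M + ∑ n ∈ Finset.range N, (t - a) ^ (n + 1) / (n + 1).factorial * r n := by
    refine abs_le_of_abs_deriv_le (hc v) (hasDerivAt_sum_expCoeff a M r N) (fun s hs => ?_) ?_ ht
    · obtain ⟨d, h1, h2⟩ := hd v s hs
      refine ⟨d, h1, ?_⟩
      have hsa : 0 ≤ s - a := sub_nonneg.2 hs.1.le
      have h3 := h2.trans (majorantOp_mono c nbr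
        (fun w => hu w s ⟨hs.1.le, hs.2.le⟩) v)
      rw [majorantOp_sum] at h3
      simp only [majorantOp_const_mul, hcoe, coe_expCoeff_eq_ofReal hs.1.le] at h3
      rw [Finset.sum_congr rfl (fun n _ => (ENNReal.ofReal_mul (by positivity)).symm),
        ← ENNReal.ofReal_sum_of_nonneg (fun n _ => mul_nonneg (by positivity) (hr0 n)),
        Real.enorm_eq_ofReal_abs] at h3
      exact (ENNReal.ofReal_le_ofReal_iff
        (Finset.sum_nonneg fun n _ => mul_nonneg (by positivity) (hr0 n))).1 h3
    · have := h0 v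
      simp only [sub_self, ne_eq, Nat.add_eq_zero_iff, one_ne_zero, and_false, not_false_eq_true,
        zero_pow, zero_div, zero_mul, Finset.sum_const_zero, add_zero]
      rw [Real.enorm_eq_ofReal_abs] at this
      exact ENNReal.ofReal_le_coe.1 this |>.trans le_rfl
  have hta : 0 ≤ t - a := sub_nonneg.2 ht.1
  rw [Real.enorm_eq_ofReal_abs]
  refine (ENNReal.ofReal_le_ofReal main).trans ?_
  rw [ENNReal.ofReal_add M.coe_nonneg (Finset.sum_nonneg fun n _ => mul_nonneg (by positivity) (hr0 n)),
    ENNReal.ofReal_sum_of_nonneg (fun n _ => mul_nonneg (by positivity) (hr0 n)),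
    ENNReal.ofReal_coe_nnreal]
  gcongr with n
  rw [hcoe, coe_expCoeff_eq_ofReal ht.1, ENNReal.ofReal_mul (by positivity)]

/-- A function that grows at most like the exponential majorant and satisfies `|u'| ≤ P|u|` is
controlled by its values at the initial time. -/
theorem enorm_le_mul_expMajorant {V E : Type*} {c : V → E → ℝ≥0∞} {nbr : V → E → V}
    {u : V → ℝ → ℝ} {a b : ℝ} {M B τ : ℝ≥0} (hτ : 0 < τ)
    (hfin : ∀ v, expMajorant c nbr (τ + τ) v ≠ ∞) (hab : b - a ≤ τ)
    (hc : ∀ v, ContinuousOn (u v) (Set.Icc a b))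
    (hd : ∀ v, ∀ t ∈ Set.Ioo a b, ∃ d, HasDerivAt (u v) d t ∧
      ‖d‖ₑ ≤ majorantOp c nbr (fun w => ‖u w t‖ₑ) v)
    (h0 : ∀ v, ‖u v a‖ₑ ≤ M)
    (hB : ∀ v, ∀ t ∈ Set.Icc a b, ‖u v t‖ₑ ≤ B * expMajorant c nbr τ v)
    (v : V) {t : ℝ} (ht : t ∈ Set.Icc a b) : ‖u v t‖ₑ ≤ M * expMajorant c nbr τ v := by
  set P := majorantOp c nbr with hP
  have hone : ∀ n v, P^[n] 1 v ≠ ∞ := fun n v =>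
    iterate_majorantOp_one_ne_top (add_pos hτ hτ) (hfin v) n
  have hA : ∀ n v, P^[n] (expMajorant c nbr τ) v ≠ ∞ := fun n v =>
    iterate_majorantOp_expMajorant_ne_top hτ (hfin v) n
  have key : ∀ N v, ∀ t ∈ Set.Icc a b, ‖u v t‖ₑ ≤
      ∑ n ∈ Finset.range N, (expCoeff (t - a).toNNReal n : ℝ≥0∞) * (M * P^[n] 1 v) +
        (expCoeff (t - a).toNNReal N : ℝ≥0∞) * (B * P^[N] (expMajorant c nbr τ) v) := by
    intro N
    induction N with
    | zero => intro v t ht; simpa [expCoeff] using hB v t ht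
    | succ N ih =>
      intro v t ht
      -- The remainder is stored as the coefficient of index `N`, so that the induction hypothesis
      -- is one sum of `N + 1` terms, as `picard_step` requires.
      let g : ℕ → V → ℝ≥0∞ := fun n v =>
        if n < N then M * P^[n] 1 v else B * P^[N] (expMajorant c nbr τ) v
      have hg1 : ∀ n < N, g n = fun v => M * P^[n] 1 v := fun n hn => by
        funext v; simp only [g, if_pos hn]
      have hg2 : ∀ n, ¬ n < N → g n = fun v => B * P^[N] (expMajorant c nbr τ) v := fun n hn => by
        funext v; simp only [g, if_neg hn]
      have hPg1 : ∀ n < N, P (g n) = fun v => M * P^[n + 1] 1 v := fun n hn => by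
        rw [hg1 n hn, hP, majorantOp_const_mul]; simp only [Function.iterate_succ_apply']
      have hPg2 : ∀ n, ¬ n < N → P (g n) = fun v => B * P^[N + 1] (expMajorant c nbr τ) v :=
        fun n hn => by
          rw [hg2 n hn, hP, majorantOp_const_mul]; simp only [Function.iterate_succ_apply']
      have := picard_step (c := c) (nbr := nbr) hc hd h0 (N := N + 1) (g := g) ?_ ?_ v ht
      · refine this.trans (le_of_eq ?_)
        rw [Finset.sum_range_succ, Finset.sum_range_succ' _ N, ← hP, hPg2 N (lt_irrefl N),
          Finset.sum_congr rfl (fun n hn => by rw [hPg1 n (Finset.mem_range.1 hn)])]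
        simp only [expCoeff, Function.iterate_zero, id, pow_zero, Nat.factorial_zero, Nat.cast_one,
          div_one, ENNReal.coe_one, one_mul, Pi.one_apply, mul_one]
        ring
      · intro n v
        rw [← hP]
        by_cases hn : n < N
        · rw [hPg1 n hn]; exact ENNReal.mul_ne_top ENNReal.coe_ne_top (hone _ v)
        · rw [hPg2 n hn]; exact ENNReal.mul_ne_top ENNReal.coe_ne_top (hA _ v)
      · intro v t ht
        refine (ih v t ht).trans (le_of_eq ?_)
        rw [Finset.sum_range_succ, hg2 N (lt_irrefl N)]
        congr 1
        exact Finset.sum_congr rfl fun n hn => by rw [hg1 n (Finset.mem_range.1 hn)]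
  have hs : (t - a).toNNReal ≤ τ := by
    rw [Real.toNNReal_le_iff_le_coe]; linarith [ht.2]
  -- The main terms are a partial sum of `M A_τ`. The remainder involves `P^N A_τ` at a time of at
  -- most `τ`, hence is a tail of the series at `τ + τ`; this is why finiteness is assumed at twice
  -- `τ`.
  have hbound : ∀ N, ‖u v t‖ₑ ≤ M * expMajorant c nbr τ v +
      B * ∑' n, (expCoeff (τ + τ) (n + N) : ℝ≥0∞) * P^[n + N] 1 v := by
    intro N
    refine (key N v t ht).trans (add_le_add ?_ ?_)
    · calc _ ≤ ∑ n ∈ Finset.range N, (M : ℝ≥0∞) * ((expCoeff τ n : ℝ≥0∞) * P^[n] 1 v) := by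
            refine Finset.sum_le_sum fun n _ => ?_
            rw [mul_left_comm]
            gcongr
            exact expCoeff_mono hs n
        _ ≤ _ := by
            rw [← Finset.mul_sum]
            gcongr
            exact ENNReal.sum_le_tsum _
    · rw [mul_left_comm]
      gcongr
      refine le_trans ?_ (expCoeff_mul_iterate_expMajorant_le c nbr τ τ N v)
      gcongr
      exact expCoeff_mono hs N
  have hlim : Filter.Tendsto (fun N => M * expMajorant c nbr τ v +
      B * ∑' n, (expCoeff (τ + τ) (n + N) : ℝ≥0∞) * P^[n + N] 1 v) Filter.atTop
      (𝓝 (M * expMajorant c nbr τ v + B * 0)) :=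
    tendsto_const_nhds.add (ENNReal.Tendsto.const_mul (tendsto_remainder (hfin v))
      (Or.inr ENNReal.coe_ne_top))
  rw [mul_zero, add_zero] at hlim
  exact ge_of_tendsto' hlim hbound

/-! ### Uniqueness for the differential inequality `|u'| ≤ P|u|` -/

/-- `u` is a family of continuous functions on `I`, bounded at each time, with `|u'| ≤ P|u|` in the
interior of `I`. -/
structure HeatInequality {V E : Type*} (c : V → E → ℝ≥0∞) (nbr : V → E → V) (I : Set ℝ)
    (u : V → ℝ → ℝ) : Prop where
  continuousOn : ∀ v, ContinuousOn (u v) I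
  deriv : ∀ v, ∀ t ∈ interior I, ∃ d, HasDerivAt (u v) d t ∧
    ‖d‖ₑ ≤ majorantOp c nbr (fun w => ‖u w t‖ₑ) v
  bounded : ∀ t ∈ I, ∃ M : ℝ≥0, ∀ v, ‖u v t‖ₑ ≤ M

/-- Near `t` in `I`, the functions `u v` are bounded by a fixed multiple of `A v`. -/
def LocallyDominated {V : Type*} (A : V → ℝ≥0∞) (I : Set ℝ) (u : V → ℝ → ℝ) (t : ℝ) : Prop :=
  ∃ B : ℝ≥0, ∀ᶠ s in 𝓝[I] t, ∀ v, ‖u v s‖ₑ ≤ B * A v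

theorem LocallyDominated.neg {V : Type*} {A : V → ℝ≥0∞} {I : Set ℝ} {u : V → ℝ → ℝ} {t : ℝ}
    (h : LocallyDominated A I u (-t)) :
    LocallyDominated A (Neg.neg ⁻¹' I) (fun v t => u v (-t)) t := by
  obtain ⟨B, hB⟩ := h
  refine ⟨B, ?_⟩
  have : Filter.Tendsto (Neg.neg : ℝ → ℝ) (𝓝[Neg.neg ⁻¹' I] t) (𝓝[I] (-t)) :=
    continuous_neg.continuousWithinAt.tendsto_nhdsWithin fun _ h => h
  exact this.eventually hB

theorem LocallyDominated.exists_forall_Icc {V : Type*} {A : V → ℝ≥0∞} {I : Set ℝ}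
    {u : V → ℝ → ℝ} {a b : ℝ} (hI : Set.Icc a b ⊆ I)
    (h : ∀ t ∈ Set.Icc a b, LocallyDominated A I u t) :
    ∃ B : ℝ≥0, ∀ t ∈ Set.Icc a b, ∀ v, ‖u v t‖ₑ ≤ B * A v := by
  refine isCompact_Icc.induction_on (p := fun s => ∃ B : ℝ≥0, ∀ t ∈ s, ∀ v, ‖u v t‖ₑ ≤ B * A v)
    ⟨0, by simp⟩ (fun s t hst ⟨B, hB⟩ => ⟨B, fun x hx => hB x (hst hx)⟩) ?_ ?_
  · rintro s t ⟨B, hB⟩ ⟨B', hB'⟩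
    refine ⟨max B B', ?_⟩
    rintro x (hx | hx) v
    · refine (hB x hx v).trans ?_
      gcongr
      exact le_max_left _ _
    · refine (hB' x hx v).trans ?_
      gcongr
      exact le_max_right _ _
  · intro x hx
    obtain ⟨B, hB⟩ := h x hx
    exact ⟨_, nhdsWithin_mono x hI hB, B, fun t ht => ht⟩

namespace HeatInequality

variable {V E : Type*} {c : V → E → ℝ≥0∞} {nbr : V → E → V} {I : Set ℝ} {u : V → ℝ → ℝ}
  {a b t : ℝ} {M B τ : ℝ≥0}

/-- Time reversal. -/
theorem neg (h : HeatInequality c nbr I u) :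
    HeatInequality c nbr (Neg.neg ⁻¹' I) (fun v t => u v (-t)) where
  continuousOn v := (h.continuousOn v).comp continuous_neg.continuousOn fun _ h => h
  deriv v t ht := by
    have ht' : -t ∈ interior I := by
      have := (Homeomorph.neg ℝ).preimage_interior I
      rw [Homeomorph.coe_neg] at this
      rwa [← this] at ht
    obtain ⟨d, h1, h2⟩ := h.deriv v (-t) ht'
    refine ⟨-d, ?_, by simpa using h2⟩
    exact (h1.comp t (hasDerivAt_neg t)).congr_deriv (by simp)
  bounded t ht := h.bounded (-t) ht

theorem le_forward (h : HeatInequality c nbr I u) (hτ : 0 < τ)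
    (hfin : ∀ v, expMajorant c nbr (τ + τ) v ≠ ∞) (hI : Set.Icc a b ⊆ I) (hab : b - a ≤ τ)
    (h0 : ∀ v, ‖u v a‖ₑ ≤ M)
    (hB : ∀ t ∈ Set.Icc a b, ∀ v, ‖u v t‖ₑ ≤ B * expMajorant c nbr τ v)
    (ht : t ∈ Set.Icc a b) (v : V) : ‖u v t‖ₑ ≤ M * expMajorant c nbr τ v :=
  enorm_le_mul_expMajorant hτ hfin hab (fun v => (h.continuousOn v).mono hI)
    (fun v s hs => h.deriv v s (interior_mono hI (by rwa [interior_Icc]))) h0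
    (fun v t ht => hB t ht v) v ht

theorem le_backward (h : HeatInequality c nbr I u) (hτ : 0 < τ)
    (hfin : ∀ v, expMajorant c nbr (τ + τ) v ≠ ∞) (hI : Set.Icc a b ⊆ I) (hab : b - a ≤ τ)
    (h0 : ∀ v, ‖u v b‖ₑ ≤ M)
    (hB : ∀ t ∈ Set.Icc a b, ∀ v, ‖u v t‖ₑ ≤ B * expMajorant c nbr τ v)
    (ht : t ∈ Set.Icc a b) (v : V) : ‖u v t‖ₑ ≤ M * expMajorant c nbr τ v := by
  have hm : ∀ {s}, s ∈ Set.Icc (-b) (-a) → -s ∈ Set.Icc a b := fun hs =>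
    ⟨le_neg.1 hs.2, neg_le.1 hs.1⟩
  have := h.neg.le_forward (a := -b) (b := -a) (t := -t) (M := M) (B := B) hτ hfin
    (fun s hs => hI (hm hs)) (by linarith) (by simpa using h0) (fun s hs => hB _ (hm hs))
    ⟨neg_le_neg ht.2, neg_le_neg ht.1⟩ v
  simpa using this

/-- Local domination may fail at `a` itself, where the local constants could blow up. Running the
estimate backwards from `b` replaces them by the bound `M'` at time `b`, the same for all times in
`(a, b]`; after that the forward estimate from `a` applies. -/
theorem le_of_locallyDominated_Ioc (h : HeatInequality c nbr I u) (hτ : 0 < τ)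
    (hfin : ∀ v, expMajorant c nbr (τ + τ) v ≠ ∞) (hI : Set.Icc a b ⊆ I) (hba : a ≤ b)
    (hab : b - a ≤ τ) (h0 : ∀ v, ‖u v a‖ₑ ≤ M)
    (hd : ∀ t ∈ Set.Ioc a b, LocallyDominated (expMajorant c nbr τ) I u t) (v : V) :
    ‖u v b‖ₑ ≤ M * expMajorant c nbr τ v := by
  obtain ⟨M', hM'⟩ := h.bounded b (hI ⟨hba, le_rfl⟩)
  refine h.le_forward (B := max M M') hτ hfin hI hab h0 (fun t ht v => ?_) ⟨hba, le_rfl⟩ v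
  rcases ht.1.eq_or_lt with rfl | hat
  · calc ‖u v a‖ₑ ≤ M * 1 := by simpa using h0 v
      _ ≤ _ := by
        gcongr
        exacts [le_max_left _ _, one_le_expMajorant c nbr τ v]
  · have hI' : Set.Icc t b ⊆ I := (Set.Icc_subset_Icc_left ht.1).trans hI
    obtain ⟨B, hB⟩ := LocallyDominated.exists_forall_Icc hI'
      fun s hs => hd s ⟨hat.trans_le hs.1, hs.2⟩
    refine (h.le_backward hτ hfin hI' (by linarith) hM' hB ⟨le_rfl, ht.2⟩ v).trans ?_
    gcongr
    exact le_max_right _ _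

theorem le_of_locallyDominated_Ico (h : HeatInequality c nbr I u) (hτ : 0 < τ)
    (hfin : ∀ v, expMajorant c nbr (τ + τ) v ≠ ∞) (hI : Set.Icc a b ⊆ I) (hba : a ≤ b)
    (hab : b - a ≤ τ) (h0 : ∀ v, ‖u v b‖ₑ ≤ M)
    (hd : ∀ t ∈ Set.Ico a b, LocallyDominated (expMajorant c nbr τ) I u t) (v : V) :
    ‖u v a‖ₑ ≤ M * expMajorant c nbr τ v := by
  have := h.neg.le_of_locallyDominated_Ioc (a := -b) (b := -a) (M := M) hτ hfin
    (fun s hs => hI ⟨le_neg.1 hs.2, neg_le.1 hs.1⟩) (neg_le_neg hba) (by linarith)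
    (by simpa using h0)
    (fun s hs => (hd (-s) ⟨le_neg.1 hs.2, neg_lt.1 hs.1⟩).neg) v
  simpa using this

/-- By Baire's theorem, boundedness at each time implies local domination. -/
theorem locallyDominated (h : HeatInequality c nbr I u) (hc : IsClosed I) (ho : I.OrdConnected)
    (hτ : 0 < τ) (hfin : ∀ v, expMajorant c nbr (τ + τ) v ≠ ∞) (ht : t ∈ I) :
    LocallyDominated (expMajorant c nbr τ) I u t := by
  by_contra hbad
  set K : Set ℝ := {t | t ∈ I ∧ ¬ LocallyDominated (expMajorant c nbr τ) I u t} with hKdef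
  -- Local domination at a time passes to all nearby times in `I`, so the bad times form a closed
  -- set.
  have hK : IsClosed K := by
    refine isClosed_of_closure_subset fun x hx => ?_
    have hxI : x ∈ I := hc.closure_subset_iff.2 (fun y hy => hy.1) hx
    refine ⟨hxI, fun ⟨B, hB⟩ => ?_⟩
    rw [mem_closure_iff_frequently] at hx
    have h1 : ∀ᶠ s in 𝓝[I] x, LocallyDominated (expMajorant c nbr τ) I u s := by
      filter_upwards [eventually_eventually_nhdsWithin.2 hB] with s hs using ⟨B, hs⟩
    rw [eventually_nhdsWithin_iff] at h1
    obtain ⟨s, hs1, hs2⟩ := (hx.and_eventually h1).exists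
    exact hs1.2 (hs2 hs1.1)
  have : CompleteSpace K := hK.completeSpace_coe
  have : Nonempty K := ⟨⟨t, ht, hbad⟩⟩
  -- Boundedness at each time covers `K` by countably many closed sets with bound `n`, so one of
  -- them has interior relative to `K`.
  obtain ⟨n, t₀, hn⟩ := nonempty_interior_of_iUnion_of_closed
    (f := fun n : ℕ => {t : K | ∀ v, ‖u v t‖ₑ ≤ ((n : ℝ≥0) : ℝ≥0∞)}) (fun n => by
      simp only [Set.ofPred_forall]
      refine isClosed_iInter fun v => isClosed_le ?_ continuous_const
      exact continuous_enorm.comp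
        ((h.continuousOn v).mono fun y hy => hy.1).domRestrict)
    (Set.eq_univ_of_forall fun s => by
      obtain ⟨M, hM⟩ := h.bounded s s.2.1
      obtain ⟨n, hn⟩ := exists_nat_ge M
      exact Set.mem_iUnion.2 ⟨n, fun v => (hM v).trans (by exact_mod_cast hn)⟩)
  obtain ⟨ε, hε, hball⟩ := Metric.isOpen_iff.1 isOpen_interior t₀ hn
  have hKn : ∀ s ∈ K, |s - t₀| < ε → ∀ v, ‖u v s‖ₑ ≤ ((n : ℝ≥0) : ℝ≥0∞) := fun s hs hst =>
    interior_subset (hball (show (⟨s, hs⟩ : K) ∈ Metric.ball t₀ ε from hst))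
  -- Here `ε` keeps the bad time nearest to `s` within the portion bounded by `n`, and `τ` limits
  -- the length of the interval on which the estimate is used.
  have hδ : 0 < min ε τ := lt_min hε hτ
  refine t₀.2.2 ⟨n, ?_⟩
  filter_upwards [self_mem_nhdsWithin, mem_nhdsWithin_of_mem_nhds (Metric.ball_mem_nhds _ hδ)]
    with s hsI hs v
  rw [Metric.mem_ball, Real.dist_eq, lt_min_iff] at hs
  rcases le_total (t₀ : ℝ) s with hle | hle
  · rw [abs_of_nonneg (sub_nonneg.2 hle)] at hs
    -- The last bad time `α` before `s`: there `u` is bounded by `n`, and all times of `(α, s]` are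
    -- good. The case `s = α` is included.
    obtain ⟨α, hα, hmax⟩ := (isCompact_Icc.inter_left hK :
      IsCompact (K ∩ Set.Icc (t₀ : ℝ) s)).exists_isGreatest ⟨t₀, t₀.2, le_rfl, hle⟩
    have hα' := hα.2
    have hsub : Set.Icc α s ⊆ I := ho.out hα.1.1 hsI
    refine h.le_of_locallyDominated_Ioc hτ hfin hsub hα'.2 (by linarith [hα'.1])
      (hKn α hα.1 ?_) (fun x hx => ?_) v
    · rw [abs_of_nonneg (sub_nonneg.2 hα'.1)]; linarith [hα'.2]
    · by_contra hx'
      exact absurd (hmax ⟨⟨hsub ⟨hx.1.le, hx.2⟩, hx'⟩, hα'.1.trans hx.1.le, hx.2⟩) (not_le.2 hx.1)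
  · rw [abs_of_nonpos (sub_nonpos.2 hle)] at hs
    obtain ⟨α, hα, hmin⟩ := (isCompact_Icc.inter_left hK :
      IsCompact (K ∩ Set.Icc s (t₀ : ℝ))).exists_isLeast ⟨t₀, t₀.2, hle, le_rfl⟩
    have hα' := hα.2
    have hsub : Set.Icc s α ⊆ I := ho.out hsI hα.1.1
    refine h.le_of_locallyDominated_Ico hτ hfin hsub hα'.1 (by linarith [hα'.2])
      (hKn α hα.1 ?_) (fun x hx => ?_) v
    · rw [abs_of_nonpos (sub_nonpos.2 hα'.2)]; linarith [hα'.1]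
    · by_contra hx'
      exact absurd (hmin ⟨⟨hsub ⟨hx.1, hx.2.le⟩, hx'⟩, hx.1, hx.2.le.trans hα'.2⟩) (not_le.2 hx.2)

/-- A solution of the differential inequality with zero initial value vanishes. -/
theorem eq_zero (h : HeatInequality c nbr I u) (hc : IsClosed I) (ho : I.OrdConnected)
    (hτ : 0 < τ) (hfin : ∀ v, expMajorant c nbr (τ + τ) v ≠ ∞) (h0I : 0 ∈ I)
    (h0 : ∀ v, u v 0 = 0) (ht : t ∈ I) (ht0 : 0 ≤ t) (v : V) : u v t = 0 := by
  -- The estimate only spans time `τ`, but `τ` does not depend on the starting time. Each step is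
  -- the case `M = 0`.
  have key : ∀ k : ℕ, ∀ t ∈ I, 0 ≤ t → t ≤ k * τ → ∀ v, u v t = 0 := by
    intro k
    induction k with
    | zero =>
      intro t _ h1 h2 v
      rw [le_antisymm (by simpa using h2) h1, h0]
    | succ k ih =>
      intro t ht h1 h2 v
      rcases le_total t (k * τ) with h3 | h3
      · exact ih t ht h1 h3 v
      · have hk : (0 : ℝ) ≤ k * τ := by positivity
        have hI : Set.Icc (k * τ : ℝ) t ⊆ I := (Set.Icc_subset_Icc_left hk).trans (ho.out h0I ht)
        obtain ⟨B, hB⟩ := LocallyDominated.exists_forall_Icc hI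
          fun s hs => h.locallyDominated hc ho hτ hfin (hI hs)
        have := h.le_forward (M := 0) hτ hfin hI (by push_cast at h2; linarith)
          (fun v => by simp [ih _ (hI ⟨le_rfl, h3⟩) hk le_rfl v]) hB ⟨h3, le_rfl⟩ v
        simpa using this
  obtain ⟨k, hk⟩ := exists_nat_ge (t / τ)
  exact key k t ht ht0 ((div_le_iff₀ (by exact_mod_cast hτ)).1 hk) v

end HeatInequality

/-! ### Bounded solutions of locally finite heat equations -/

/-- The solution of `x' = h - r x` on `[0, ∞)` with initial value `x₀`, extended to negative times
by `x₀`. -/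
noncomputable def mildSolution (r x₀ : ℝ) (h : ℝ → ℝ) (t : ℝ) : ℝ :=
  Real.exp (-(r * max t 0)) * (x₀ + ∫ s in (0 : ℝ)..max t 0, Real.exp (r * s) * h s)

section MildSolution

variable {r x₀ : ℝ} {h h' : ℝ → ℝ}

theorem mildSolution_zero : mildSolution r x₀ h 0 = x₀ := by simp [mildSolution]

theorem intervalIntegrable_exp_mul {M : ℝ} (hm : Measurable h) (hM : ∀ t, |h t| ≤ M) (a b : ℝ) :
    IntervalIntegrable (fun s => Real.exp (r * s) * h s) MeasureTheory.volume a b := by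
  have h1 : IntervalIntegrable (fun s => Real.exp (r * s) * M) MeasureTheory.volume a b :=
    (by fun_prop : Continuous fun s => Real.exp (r * s) * M).intervalIntegrable a b
  refine h1.mono_fun (by fun_prop) (Filter.Eventually.of_forall fun s => ?_)
  simp only [norm_mul, Real.norm_eq_abs]
  exact mul_le_mul_of_nonneg_left ((hM s).trans (le_abs_self M)) (abs_nonneg _)

theorem continuous_mildSolution {M : ℝ} (hm : Measurable h) (hM : ∀ t, |h t| ≤ M) :
    Continuous (mildSolution r x₀ h) := by
  have h1 : Continuous fun t => ∫ s in (0 : ℝ)..t, Real.exp (r * s) * h s :=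
    intervalIntegral.continuous_primitive (intervalIntegrable_exp_mul hm hM) 0
  have h2 : Continuous fun t : ℝ => max t 0 := by fun_prop
  unfold mildSolution
  exact (by fun_prop : Continuous fun t : ℝ => Real.exp (-(r * max t 0))).mul
    (continuous_const.add (h1.comp h2))

theorem mildSolution_mono {M : ℝ} (hm : Measurable h) (hM : ∀ t, |h t| ≤ M)
    (hm' : Measurable h') (hM' : ∀ t, |h' t| ≤ M) (hh : ∀ t, h t ≤ h' t) (t : ℝ) :
    mildSolution r x₀ h t ≤ mildSolution r x₀ h' t := by
  unfold mildSolution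
  gcongr
  refine intervalIntegral.integral_mono_on (le_max_right _ _) (intervalIntegrable_exp_mul hm hM _ _)
    (intervalIntegrable_exp_mul hm' hM' _ _) fun s _ => ?_
  gcongr
  exact hh s

theorem mildSolution_nonneg (hx : 0 ≤ x₀) (hh : ∀ t, 0 ≤ h t) (t : ℝ) :
    0 ≤ mildSolution r x₀ h t := by
  refine mul_nonneg (Real.exp_pos _).le (add_nonneg hx ?_)
  exact intervalIntegral.integral_nonneg (le_max_right _ _)
    fun s _ => mul_nonneg (Real.exp_pos _).le (hh s)

/-- The constant `M` is an equilibrium for the source `r * M`; comparison with it gives the upper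
bound in `mildSolution_le`. -/
theorem mildSolution_const (M : ℝ) (t : ℝ) : mildSolution r M (fun _ => r * M) t = M := by
  unfold mildSolution
  have h1 : ∀ s : ℝ, HasDerivAt (fun s => Real.exp (r * s) * M) (Real.exp (r * s) * (r * M)) s := by
    intro s
    have := (((hasDerivAt_id s).const_mul r).exp).mul_const M
    refine this.congr_deriv ?_
    simp only [id]
    ring
  rw [intervalIntegral.integral_eq_sub_of_hasDerivAt (fun s _ => h1 s)
    ((by fun_prop : Continuous fun s => Real.exp (r * s) * (r * M)).intervalIntegrable _ _)]
  simp only [mul_zero, Real.exp_zero, one_mul, add_sub_cancel]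
  rw [← mul_assoc, ← Real.exp_add]
  simp

theorem mildSolution_le {M : ℝ} (hm : Measurable h) (h0 : ∀ t, 0 ≤ h t)
    (hM : ∀ t, h t ≤ r * M) (hx : x₀ ≤ M) (t : ℝ) :
    mildSolution r x₀ h t ≤ M := by
  have h1 := mildSolution_mono (r := r) (x₀ := x₀) (M := r * M) (h' := fun _ => r * M) hm
    (fun t => by rw [abs_of_nonneg (h0 t)]; exact hM t) measurable_const
    (fun t => by rw [abs_of_nonneg ((h0 t).trans (hM t))]) hM t
  refine h1.trans (le_of_le_of_eq ?_ (mildSolution_const (r := r) M t))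
  unfold mildSolution
  gcongr

theorem tendsto_mildSolution {M : ℝ} {g : ℕ → ℝ → ℝ} (hm : ∀ n, Measurable (g n))
    (hM : ∀ n t, |g n t| ≤ M) (hlim : ∀ t, Filter.Tendsto (fun n => g n t) Filter.atTop (𝓝 (h t)))
    (t : ℝ) : Filter.Tendsto (fun n => mildSolution r x₀ (g n) t) Filter.atTop
      (𝓝 (mildSolution r x₀ h t)) := by
  refine (tendsto_const_nhds.add ?_).const_mul _
  refine intervalIntegral.tendsto_integral_filter_of_dominated_convergence
    (fun s => Real.exp (r * s) * M) (Filter.Eventually.of_forall fun n => ?_)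
    (Filter.Eventually.of_forall fun n => Filter.Eventually.of_forall fun s _ => ?_)
    ((by fun_prop : Continuous fun s => Real.exp (r * s) * M).intervalIntegrable _ _)
    (Filter.Eventually.of_forall fun s _ => (hlim s).const_mul _)
  · have := hm n
    fun_prop
  · simp only [norm_mul, Real.norm_eq_abs, Real.abs_exp]
    gcongr
    exact hM n s

theorem hasDerivAt_mildSolution (hh : Continuous h) {t : ℝ} (ht : 0 < t) :
    HasDerivAt (mildSolution r x₀ h) (h t - r * mildSolution r x₀ h t) t := by
  have hc : Continuous fun s => Real.exp (r * s) * h s := by fun_prop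
  have h1 : HasDerivAt (fun t => ∫ s in (0 : ℝ)..t, Real.exp (r * s) * h s)
      (Real.exp (r * t) * h t) t := hc.integral_hasStrictDerivAt 0 t |>.hasDerivAt
  have h2 : HasDerivAt (fun t => Real.exp (-(r * t))) (Real.exp (-(r * t)) * -(r * 1)) t :=
    (((hasDerivAt_id t).const_mul r).neg).exp
  have h3 := h2.mul (h1.const_add x₀)
  have h4 : mildSolution r x₀ h =ᶠ[𝓝 t]
      fun t => Real.exp (-(r * t)) * (x₀ + ∫ s in (0 : ℝ)..t, Real.exp (r * s) * h s) := by
    filter_upwards [lt_mem_nhds ht] with s hs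
    simp only [mildSolution, max_eq_left hs.le]
  refine (h3.congr_of_eventuallyEq h4).congr_deriv ?_
  rw [h4.eq_of_nhds]
  have h5 : Real.exp (-(r * t)) * (Real.exp (r * t) * h t) = h t := by
    rw [← mul_assoc, ← Real.exp_add]; simp
  linear_combination h5

end MildSolution

/-! ### Monotone Picard iteration on the vertices -/

section Existence

variable {V E : Type*} (s : V → Finset E) (c : V → E → ℝ) (nbr : V → E → V)

/-- The Picard iterates of the heat equation `u' = ∑ₑ c(v, e) (u(nbr(v, e)) - u(v))`. -/
noncomputable def heatIterate (f : V → ℝ) : ℕ → V → ℝ → ℝ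
  | 0 => fun _ _ => 0
  | n + 1 => fun v => mildSolution (∑ e ∈ s v, c v e) (f v)
      fun t => ∑ e ∈ s v, c v e * heatIterate f n (nbr v e) t

variable {s c nbr}

theorem sum_mul_mem_Icc (hc : ∀ v e, 0 ≤ c v e) {M : ℝ} {g : V → ℝ}
    (hg : ∀ v, g v ∈ Set.Icc 0 M) (v : V) :
    ∑ e ∈ s v, c v e * g (nbr v e) ∈ Set.Icc 0 ((∑ e ∈ s v, c v e) * M) := by
  constructor
  · exact Finset.sum_nonneg fun e _ => mul_nonneg (hc v e) (hg _).1
  · rw [Finset.sum_mul]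
    exact Finset.sum_le_sum fun e _ => mul_le_mul_of_nonneg_left (hg _).2 (hc v e)

theorem abs_sum_mul_le (hc : ∀ v e, 0 ≤ c v e) {M : ℝ} {g : V → ℝ}
    (hg : ∀ v, g v ∈ Set.Icc 0 M) (v : V) :
    |∑ e ∈ s v, c v e * g (nbr v e)| ≤ (∑ e ∈ s v, c v e) * M := by
  have := sum_mul_mem_Icc (s := s) (nbr := nbr) hc hg v
  rw [abs_of_nonneg this.1]
  exact this.2

theorem heatIterate_continuous_and_mem_Icc (hc : ∀ v e, 0 ≤ c v e) {f : V → ℝ} {M : ℝ}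
    (hf : ∀ v, f v ∈ Set.Icc 0 M) (n : ℕ) (v : V) :
    Continuous (heatIterate s c nbr f n v) ∧ ∀ t, heatIterate s c nbr f n v t ∈ Set.Icc 0 M := by
  induction n generalizing v with
  | zero => exact ⟨continuous_const, fun t => ⟨le_rfl, (hf v).1.trans (hf v).2⟩⟩
  | succ n ih =>
    have hcont : Continuous fun t => ∑ e ∈ s v, c v e * heatIterate s c nbr f n (nbr v e) t :=
      continuous_finsetSum _ fun e _ => (ih (nbr v e)).1.const_mul _
    refine ⟨continuous_mildSolution hcont.measurable
      fun t => abs_sum_mul_le hc (g := fun v => heatIterate s c nbr f n v t) (fun w => (ih w).2 t) v,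
      fun t => ⟨?_, ?_⟩⟩
    · exact mildSolution_nonneg (hf v).1
        (fun t => (sum_mul_mem_Icc hc (g := fun v => heatIterate s c nbr f n v t)
          (fun w => (ih w).2 t) v).1) t
    · exact mildSolution_le hcont.measurable
        (fun t => (sum_mul_mem_Icc hc (g := fun v => heatIterate s c nbr f n v t)
          (fun w => (ih w).2 t) v).1)
        (fun t => (sum_mul_mem_Icc hc (g := fun v => heatIterate s c nbr f n v t)
          (fun w => (ih w).2 t) v).2) (hf v).2 t

theorem heatIterate_le_succ (hc : ∀ v e, 0 ≤ c v e) {f : V → ℝ} {M : ℝ}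
    (hf : ∀ v, f v ∈ Set.Icc 0 M) (n : ℕ) (v : V) (t : ℝ) :
    heatIterate s c nbr f n v t ≤ heatIterate s c nbr f (n + 1) v t := by
  induction n generalizing v t with
  | zero => exact ((heatIterate_continuous_and_mem_Icc hc hf 1 v).2 t).1
  | succ n ih =>
    have h := heatIterate_continuous_and_mem_Icc (s := s) (nbr := nbr) hc hf
    have hcont : ∀ n, Continuous fun t => ∑ e ∈ s v, c v e * heatIterate s c nbr f n (nbr v e) t :=
      fun n => continuous_finsetSum _ fun e _ => (h n (nbr v e)).1.const_mul _
    exact mildSolution_mono (hcont n).measurable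
      (fun t => abs_sum_mul_le hc (g := fun v => heatIterate s c nbr f n v t)
        (fun w => (h n w).2 t) v) (hcont (n + 1)).measurable
      (fun t => abs_sum_mul_le hc (g := fun v => heatIterate s c nbr f (n + 1) v t)
        (fun w => (h (n + 1) w).2 t) v)
      (fun t => Finset.sum_le_sum fun e _ => mul_le_mul_of_nonneg_left (ih _ _) (hc v e)) t

theorem exists_heat_solution_of_nonneg (hc : ∀ v e, 0 ≤ c v e) {f : V → ℝ} {M : ℝ}
    (hf : ∀ v, f v ∈ Set.Icc 0 M) :
    ∃ u : V → ℝ → ℝ, (∀ v, Continuous (u v)) ∧ (∀ v t, u v t ∈ Set.Icc 0 M) ∧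
      (∀ v, u v 0 = f v) ∧ (∀ v, s v = ∅ → ∀ t, u v t = f v) ∧
      ∀ v t, 0 < t → HasDerivAt (u v) (∑ e ∈ s v, c v e * (u (nbr v e) t - u v t)) t := by
  have h := heatIterate_continuous_and_mem_Icc (s := s) (nbr := nbr) hc hf
  set u : V → ℝ → ℝ := fun v t => ⨆ n, heatIterate s c nbr f n v t with hu
  have hlim : ∀ v t, Filter.Tendsto (fun n => heatIterate s c nbr f n v t) Filter.atTop
      (𝓝 (u v t)) := fun v t => tendsto_atTop_ciSup
    (monotone_nat_of_le_succ fun n => heatIterate_le_succ hc hf n v t)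
    ⟨M, by rintro _ ⟨n, rfl⟩; exact ((h n v).2 t).2⟩
  have hmem : ∀ v t, u v t ∈ Set.Icc 0 M := fun v t =>
    isClosed_Icc.mem_of_tendsto (hlim v t) (Filter.Eventually.of_forall fun n => (h n v).2 t)
  -- A pointwise limit is a priori only measurable. That suffices for the integral equation, which
  -- then yields continuity and in turn differentiability.
  have hmeas : ∀ v, Measurable (u v) := fun v =>
    measurable_of_tendsto_metrizable (fun n => (h n v).1.measurable) (tendsto_pi_nhds.2 (hlim v))
  have hmild : ∀ v, u v = mildSolution (∑ e ∈ s v, c v e) (f v)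
      fun t => ∑ e ∈ s v, c v e * u (nbr v e) t := by
    intro v
    ext t
    have h1 : Filter.Tendsto (fun n => heatIterate s c nbr f (n + 1) v t) Filter.atTop
        (𝓝 (mildSolution (∑ e ∈ s v, c v e) (f v) (fun t => ∑ e ∈ s v, c v e * u (nbr v e) t) t)) :=
      tendsto_mildSolution
        (fun n => (continuous_finsetSum _ fun e _ => (h n (nbr v e)).1.const_mul _).measurable)
        (fun n t => abs_sum_mul_le hc (g := fun v => heatIterate s c nbr f n v t)
          (fun w => (h n w).2 t) v)
        (fun t => tendsto_finsetSum _ fun e _ => (hlim _ t).const_mul _) t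
    exact tendsto_nhds_unique ((Filter.tendsto_add_atTop_iff_nat 1).2 (hlim v t)) h1
  have hcont : ∀ v, Continuous (u v) := by
    intro v
    rw [hmild]
    refine continuous_mildSolution
      (Finset.measurable_sum _ fun e _ => (hmeas (nbr v e)).const_mul _)
      fun t => abs_sum_mul_le hc (g := fun v => u v t) (fun w => hmem w t) v
  refine ⟨u, hcont, hmem, fun v => by rw [hmild, mildSolution_zero], fun v hv t => ?_,
    fun v t ht => ?_⟩
  · rw [hmild]; simp [mildSolution, hv]
  · have h1 := hasDerivAt_mildSolution (r := ∑ e ∈ s v, c v e) (x₀ := f v)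
      (h := fun t => ∑ e ∈ s v, c v e * u (nbr v e) t)
      (continuous_finsetSum _ fun e _ => (hcont (nbr v e)).const_mul _) ht
    rw [← hmild] at h1
    refine h1.congr_deriv ?_
    simp only [mul_sub, Finset.sum_sub_distrib, Finset.sum_mul]

/-- Solve for the positive and negative parts of `f` and subtract. The bound stays `M` because both
solutions lie in `[0, M]`. -/
theorem exists_heat_solution (hc : ∀ v e, 0 ≤ c v e) {f : V → ℝ} {M : ℝ}
    (hf : ∀ v, |f v| ≤ M) :
    ∃ u : V → ℝ → ℝ, (∀ v, Continuous (u v)) ∧ (∀ v t, |u v t| ≤ M) ∧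
      (∀ v, u v 0 = f v) ∧ (∀ v, s v = ∅ → ∀ t, u v t = f v) ∧
      ∀ v t, 0 < t → HasDerivAt (u v) (∑ e ∈ s v, c v e * (u (nbr v e) t - u v t)) t := by
  obtain ⟨u, h1, h2, h3, h4, h5⟩ := exists_heat_solution_of_nonneg (s := s) (nbr := nbr) hc
    (f := fun v => max (f v) 0) (M := M) fun v =>
      ⟨le_max_right _ _, max_le ((le_abs_self _).trans (hf v)) ((abs_nonneg _).trans (hf v))⟩
  obtain ⟨w, k1, k2, k3, k4, k5⟩ := exists_heat_solution_of_nonneg (s := s) (nbr := nbr) hc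
    (f := fun v => max (-f v) 0) (M := M) fun v =>
      ⟨le_max_right _ _, max_le ((neg_le_abs _).trans (hf v)) ((abs_nonneg _).trans (hf v))⟩
  have hmax : ∀ x : ℝ, max x 0 - max (-x) 0 = x := fun x => by
    rcases le_total x 0 with hx | hx
    · rw [max_eq_right hx, max_eq_left (neg_nonneg.2 hx)]; ring
    · rw [max_eq_left hx, max_eq_right (neg_nonpos.2 hx)]; ring
  refine ⟨fun v t => u v t - w v t, fun v => (h1 v).sub (k1 v), fun v t => ?_,
    fun v => by simp only [h3, k3, hmax],
    fun v hv t => by simp only [h4 v hv, k4 v hv, hmax], fun v t ht => ?_⟩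
  · rw [abs_le]
    constructor <;> linarith [(h2 v t).1, (h2 v t).2, (k2 v t).1, (k2 v t).2]
  · refine ((h5 v t ht).sub (k5 v t ht)).congr_deriv ?_
    rw [← Finset.sum_sub_distrib]
    exact Finset.sum_congr rfl fun e _ => by ring

end Existence

/-! ### Linear interpolation on the geometric realization -/

namespace CalcGraph

variable {V E : Type*} (G : CalcGraph V E)

theorem pt_zero (e : E) : G.pt e 0 = .vertex (G.src e) := by simp [pt]

theorem pt_len (e : E) : G.pt e (G.len e) = .vertex (G.tgt e) := by
  simp [pt, (G.len_pos e).not_ge]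

theorem pt_of_mem_Ioo {e : E} {s : ℝ} (hs : s ∈ Set.Ioo 0 (G.len e)) :
    G.pt e s = .inner e s hs := by
  simp only [pt, dif_pos hs]

/-- The function on the geometric realization that is linear on each edge and has the given values
at the vertices. -/
noncomputable def interp (g : V → ℝ) : G.Point → ℝ
  | .vertex v => g v
  | .inner e s _ => g (G.src e) + (g (G.tgt e) - g (G.src e)) / G.len e * s

variable {G}

theorem Icc_zero_len_cases {e : E} {s : ℝ} (hs : s ∈ Set.Icc 0 (G.len e)) :
    s = 0 ∨ s = G.len e ∨ s ∈ Set.Ioo 0 (G.len e) := by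
  rcases hs.1.eq_or_lt with h | h
  · exact .inl h.symm
  rcases hs.2.eq_or_lt with h' | h'
  · exact .inr (.inl h')
  · exact .inr (.inr ⟨h, h'⟩)

theorem interp_pt (g : V → ℝ) {e : E} {s : ℝ} (hs : s ∈ Set.Icc 0 (G.len e)) :
    G.interp g (G.pt e s) = g (G.src e) + (g (G.tgt e) - g (G.src e)) / G.len e * s := by
  rcases Icc_zero_len_cases hs with rfl | rfl | h
  · rw [pt_zero]; simp [interp]
  · rw [pt_len, div_mul_cancel₀ _ (G.len_pos e).ne']; simp [interp]
  · rw [G.pt_of_mem_Ioo h]; rfl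

/-- Bounds at the vertices extend to the linear interpolation. -/
theorem abs_interp_le {g h : V → ℝ} (hg : ∀ v, |g v| ≤ h v) (p : G.Point) :
    |G.interp g p| ≤ G.interp h p := by
  cases p with
  | vertex v => exact hg v
  | inner e s hs =>
    have hl := G.len_pos e
    have h0 : 0 ≤ s / G.len e := div_nonneg hs.1.le hl.le
    have h1 : 0 ≤ 1 - s / G.len e := sub_nonneg.2 ((div_le_one hl).2 hs.2.le)
    have key : ∀ g : V → ℝ, G.interp g (.inner e s hs) =
        (1 - s / G.len e) * g (G.src e) + s / G.len e * g (G.tgt e) := fun g => by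
      simp only [interp]; ring
    rw [key, key]
    refine (abs_add_le _ _).trans ?_
    rw [abs_mul, abs_mul, abs_of_nonneg h0, abs_of_nonneg h1]
    gcongr <;> apply hg

theorem interp_sub (g h : V → ℝ) (p : G.Point) :
    G.interp (fun v => g v - h v) p = G.interp g p - G.interp h p := by
  cases p with
  | vertex v => rfl
  | inner e s hs => simp only [interp]; ring

theorem interp_const (a : ℝ) (p : G.Point) : G.interp (fun _ => a) p = a := by
  cases p with
  | vertex v => rfl
  | inner e s hs => simp [interp]

theorem interp_const_mul (a : ℝ) (g : V → ℝ) (p : G.Point) :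
    G.interp (fun v => a * g v) p = a * G.interp g p := by
  cases p with
  | vertex v => rfl
  | inner e s hs => simp only [interp]; ring

theorem HasPath.abs_sub_le {φ : G.Point → ℝ} {K : ℝ}
    (hφ : ∀ e, ∀ s ∈ Set.Icc 0 (G.len e), ∀ t ∈ Set.Icc 0 (G.len e),
      |φ (G.pt e s) - φ (G.pt e t)| ≤ K * |s - t|)
    {p q : G.Point} {r : ℝ} (h : G.HasPath p q r) : |φ p - φ q| ≤ K * r := by
  induction h with
  | refl p => simp
  | @step q r e s t hs ht _ ih =>
    calc |φ (G.pt e s) - φ q| ≤ |φ (G.pt e s) - φ (G.pt e t)| + |φ (G.pt e t) - φ q| :=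
          _root_.abs_sub_le _ _ _
      _ ≤ K * |s - t| + K * r := add_le_add (hφ e s hs t ht) ih
      _ = _ := by ring

theorem exists_inv_len_le (hG : G.LocallyFinite) (v : V) :
    ∃ K : ℝ, 0 ≤ K ∧ ∀ e, G.Incident e v → (G.len e)⁻¹ ≤ K := by
  obtain ⟨K, hK⟩ := ((hG v).image fun e => (G.len e)⁻¹).bddAbove
  exact ⟨max K 0, le_max_right _ _, fun e he =>
    (hK (Set.mem_image_of_mem _ he)).trans (le_max_left _ _)⟩

/-- The interpolation of the function that is `0` at `v` and `1` at all other vertices is a barrier.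
Up to the factor `2M` it dominates the deviation of `g` from `g v`, and its slope vanishes except on
edges at `v`, where finiteness of their number bounds it. Thus `K` does not depend on `g`. -/
theorem exists_abs_interp_sub_vertex_le (hG : G.LocallyFinite) (v : V) {M : ℝ} (hM : 0 ≤ M) :
    ∃ K, 0 ≤ K ∧ ∀ g : V → ℝ, (∀ v, |g v| ≤ M) → ∀ q r, G.HasPath (.vertex v) q r →
      |G.interp g q - G.interp g (.vertex v)| ≤ K * r := by
  classical
  obtain ⟨K, hK0, hK⟩ := exists_inv_len_le hG v
  refine ⟨2 * M * K, by positivity, fun g hg q r h => ?_⟩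
  set χ : V → ℝ := fun w => if w = v then 0 else 1 with hχ
  have hχv : χ v = 0 := if_pos rfl
  have hslope : ∀ e, |(χ (G.tgt e) - χ (G.src e)) / G.len e| ≤ K := by
    intro e
    rw [abs_div, abs_of_pos (G.len_pos e)]
    by_cases he : G.Incident e v
    · refine le_trans ?_ (hK e he)
      rw [div_eq_mul_inv]
      refine mul_le_of_le_one_left (inv_nonneg.2 (G.len_pos e).le) ?_
      simp only [hχ]
      split_ifs <;> norm_num
    · have h1 : ¬ G.src e = v := fun h => he (.inl h)
      have h2 : ¬ G.tgt e = v := fun h => he (.inr h)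
      simpa [hχ, h1, h2] using hK0
  have h1 : |G.interp χ (.vertex v) - G.interp χ q| ≤ K * r := by
    refine HasPath.abs_sub_le (fun e s hs t ht => ?_) h
    rw [interp_pt χ hs, interp_pt χ ht, add_sub_add_left_eq_sub, ← mul_sub, abs_mul]
    exact mul_le_mul_of_nonneg_right (hslope e) (abs_nonneg _)
  have h2 : |G.interp (fun w => g w - g v) q| ≤ G.interp (fun w => 2 * M * χ w) q := by
    refine abs_interp_le (fun w => ?_) q
    by_cases hw : w = v
    · simp [hw, hχv]
    · simp only [hχ, if_neg hw, mul_one]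
      linarith [abs_sub (g w) (g v), hg w, hg v]
  rw [interp_sub, interp_const, interp_const_mul] at h2
  refine h2.trans ?_
  rw [mul_assoc (2 * M)]
  refine mul_le_mul_of_nonneg_left ?_ (by positivity)
  have h3 : G.interp χ (.vertex v) = 0 := hχv
  rw [h3, zero_sub, abs_neg] at h1
  exact (le_abs_self _).trans h1

/-- The tent function around the point of the edge interior of `e₀` with parameter `s₀`. -/
noncomputable def tent (e₀ : E) (s₀ δ : ℝ) : G.Point → ℝ
  | .vertex _ => 1
  | .inner e s _ => by classical exact if e = e₀ then min 1 (|s - s₀| / δ) else 1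

/-- The barrier is now the tent, with `δ` the distance along `e₀` to the nearer end. It already
equals `1` at both ends, so it extends continuously by `1`. On `e₀` the slope of the interpolation
is at most `2M / ℓ ≤ 2M / δ`. -/
theorem exists_abs_interp_sub_inner_le (e₀ : E) (s₀ : ℝ) (hs₀ : s₀ ∈ Set.Ioo 0 (G.len e₀)) {M : ℝ}
    (hM : 0 ≤ M) :
    ∃ K, 0 ≤ K ∧ ∀ g : V → ℝ, (∀ v, |g v| ≤ M) → ∀ q r, G.HasPath (.inner e₀ s₀ hs₀) q r →
      |G.interp g q - G.interp g (.inner e₀ s₀ hs₀)| ≤ K * r := by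
  classical
  set δ := min s₀ (G.len e₀ - s₀) with hδ
  have hδ0 : 0 < δ := lt_min hs₀.1 (sub_pos.2 hs₀.2)
  refine ⟨2 * M * δ⁻¹, by positivity, fun g hg q r h => ?_⟩
  have htent : ∀ e, ∀ s ∈ Set.Icc 0 (G.len e),
      G.tent e₀ s₀ δ (G.pt e s) = if e = e₀ then min 1 (|s - s₀| / δ) else 1 := by
    intro e s hs
    rcases Icc_zero_len_cases hs with rfl | rfl | h
    · rw [pt_zero]
      split_ifs with he
      · rw [zero_sub, abs_neg, abs_of_pos hs₀.1, min_eq_left]; · rfl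
        exact (one_le_div hδ0).2 (min_le_left _ _)
      · rfl
    · rw [pt_len]
      split_ifs with he
      · subst he
        rw [abs_of_pos (sub_pos.2 hs₀.2), min_eq_left]; · rfl
        exact (one_le_div hδ0).2 (min_le_right _ _)
      · rfl
    · rw [G.pt_of_mem_Ioo h]; rfl
  have h1 : |G.tent e₀ s₀ δ (.inner e₀ s₀ hs₀) - G.tent e₀ s₀ δ q| ≤ δ⁻¹ * r := by
    refine HasPath.abs_sub_le (fun e s hs t ht => ?_) h
    rw [htent e s hs, htent e t ht]
    split_ifs with he
    · refine (abs_min_sub_min_le_max _ _ _ _).trans ?_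
      rw [sub_self, abs_zero, max_eq_right (abs_nonneg _), ← sub_div, abs_div, abs_of_pos hδ0,
        div_eq_inv_mul]
      refine mul_le_mul_of_nonneg_left ?_ (inv_nonneg.2 hδ0.le)
      exact (abs_abs_sub_abs_le (s - s₀) (t - s₀)).trans_eq (by rw [sub_sub_sub_cancel_right])
    · rw [sub_self, abs_zero]; positivity
  have h2 : |G.interp g q - G.interp g (.inner e₀ s₀ hs₀)| ≤ 2 * M * G.tent e₀ s₀ δ q := by
    have hb : ∀ p, |G.interp g p| ≤ M := fun p => (abs_interp_le hg p).trans_eq (interp_const M p)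
    have hb2 : |G.interp g q - G.interp g (.inner e₀ s₀ hs₀)| ≤ 2 * M * 1 := by
      linarith [abs_sub (G.interp g q) (G.interp g (.inner e₀ s₀ hs₀)), hb q,
        hb (.inner e₀ s₀ hs₀)]
    cases q with
    | vertex v => exact hb2
    | inner e s hs =>
      by_cases he : e = e₀
      · subst he
        have h3 : G.tent e s₀ δ (.inner e s hs) = min 1 (|s - s₀| / δ) := if_pos rfl
        rw [h3, mul_min_of_nonneg _ _ (by positivity)]
        refine le_min hb2 ?_
        simp only [interp]
        rw [add_sub_add_left_eq_sub, ← mul_sub, abs_mul, abs_div, abs_of_pos (G.len_pos e),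
          ← mul_div_assoc, div_mul_eq_mul_div]
        refine div_le_div₀ (by positivity) ?_ hδ0 ?_
        · gcongr
          linarith [abs_sub (g (G.tgt e)) (g (G.src e)), hg (G.tgt e), hg (G.src e)]
        · exact (min_le_left _ _).trans hs₀.2.le
      · have h3 : G.tent e₀ s₀ δ (.inner e s hs) = 1 := if_neg he
        rwa [h3]
  refine h2.trans ?_
  rw [mul_assoc (2 * M)]
  refine mul_le_mul_of_nonneg_left ?_ (by positivity)
  have h3 : G.tent e₀ s₀ δ (.inner e₀ s₀ hs₀) = 0 := by
    simp [tent]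
  rw [h3, zero_sub, abs_neg] at h1
  exact (le_abs_self _).trans h1

theorem exists_abs_interp_sub_le (hG : G.LocallyFinite) (p : G.Point) {M : ℝ} (hM : 0 ≤ M) :
    ∃ K, 0 ≤ K ∧ ∀ g : V → ℝ, (∀ v, |g v| ≤ M) → ∀ q r, G.HasPath p q r →
      |G.interp g q - G.interp g p| ≤ K * r := by
  cases p with
  | vertex v => exact exists_abs_interp_sub_vertex_le hG v hM
  | inner e s hs => exact exists_abs_interp_sub_inner_le e s hs hM

theorem continuous_interp_time {w : V → ℝ → ℝ} (hw : ∀ v, Continuous (w v)) (p : G.Point) :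
    Continuous fun t => G.interp (fun v => w v t) p := by
  cases p with
  | vertex v => exact hw v
  | inner e s hs =>
    have h1 := hw (G.src e)
    have h2 := hw (G.tgt e)
    simp only [interp]
    fun_prop

theorem continuous_interp (hG : G.LocallyFinite) {w : V → ℝ → ℝ} (hw : ∀ v, Continuous (w v))
    {M : ℝ} (hM : ∀ v t, |w v t| ≤ M) :
    Continuous fun p : G.Point × ℝ => G.interp (fun v => w v p.2) p.1 := by
  rw [continuous_iff_continuousAt]
  rintro ⟨p, t₀⟩
  -- `K` serves all times at once, so joint continuity reduces to continuity in time at the fixed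
  -- point `p`.
  obtain ⟨K, hK0, hK⟩ := exists_abs_interp_sub_le hG p (le_max_right M 0)
  rw [ContinuousAt, Metric.tendsto_nhds]
  intro ε hε
  have h1 : ∀ᶠ q in 𝓝 p, edist q p < ENNReal.ofReal (ε / 2 / (K + 1)) :=
    Metric.eball_mem_nhds _ (ENNReal.ofReal_pos.2 (by positivity))
  have h2 : ∀ᶠ t in 𝓝 t₀,
      dist (G.interp (fun v => w v t) p) (G.interp (fun v => w v t₀) p) < ε / 2 :=
    Metric.tendsto_nhds.1 (continuous_interp_time hw p).continuousAt _ (by positivity)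
  rw [nhds_prod_eq]
  filter_upwards [h1.prod_mk h2] with ⟨q, t⟩ ⟨hq, ht⟩
  have hq' : G.pathDist p q < ENNReal.ofReal (ε / 2 / (K + 1)) := by rw [edist_comm] at hq; exact hq
  obtain ⟨r, hr, hrε⟩ := by simpa only [pathDist, iInf_lt_iff] using hq'
  have hr' : r < ε / 2 / (K + 1) := (ENNReal.ofReal_lt_ofReal_iff_of_nonneg hr.nonneg).1 hrε
  have h3 := hK (fun v => w v t) (fun v => (hM v t).trans (le_max_left _ _)) q r hr
  rw [lt_div_iff₀ (by positivity)] at hr'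
  have h4 : K * r ≤ r * (K + 1) := by linarith [hr.nonneg]
  refine (dist_triangle _ (G.interp (fun v => w v t) p) _).trans_lt ?_
  rw [Real.dist_eq]
  simp only at ht ⊢
  linarith

theorem edgewiseLinear_interp (hG : G.LocallyFinite) {g : V → ℝ} {M : ℝ} (hM : ∀ v, |g v| ≤ M) :
    G.EdgewiseLinear (G.interp g) :=
  ⟨(continuous_interp hG (w := fun v _ => g v) (fun _ => continuous_const)
    (fun v _ => hM v)).comp (Continuous.prodMk_left (0 : ℝ)),
    fun _ => ⟨_, _, fun _ hs => interp_pt g ⟨hs.1.le, hs.2.le⟩⟩⟩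

theorem continuousOn_pt (e : E) : ContinuousOn (G.pt e) (Set.Icc 0 (G.len e)) := by
  refine LipschitzOnWith.continuousOn (K := 1) fun s hs t ht => ?_
  rw [ENNReal.coe_one, one_mul, edist_dist, Real.dist_eq]
  have := pathDist_le (HasPath.step e s t hs ht (.refl _))
  rwa [add_zero] at this

/-- Continuity extends the affine formula from the open edge to its ends, where it determines both
coefficients from the vertex values. -/
theorem EdgewiseLinear.eq_interp {f : G.Point → ℝ} (hf : G.EdgewiseLinear f) (p : G.Point) :
    f p = G.interp (fun v => f (.vertex v)) p := by
  cases p with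
  | vertex v => rfl
  | inner e s hs =>
    obtain ⟨a, b, hab⟩ := hf.2 e
    have hl := G.len_pos e
    have h1 : Set.EqOn (fun s => f (G.pt e s)) (fun s => a + b * s) (Set.Icc 0 (G.len e)) :=
      Set.EqOn.of_subset_closure hab (hf.1.comp_continuousOn (continuousOn_pt e))
        (by fun_prop) Set.Ioo_subset_Icc_self (closure_Ioo hl.ne).superset
    have h2 := h1 ⟨le_rfl, hl.le⟩
    have h3 := h1 ⟨hl.le, le_rfl⟩
    have h4 := hab s hs
    simp only [pt_zero, pt_len] at h2 h3
    rw [G.pt_of_mem_Ioo hs] at h4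
    simp only [interp]
    rw [h2, h3, h4]
    field_simp
    ring

end CalcGraph

/-! ### Uniqueness and existence for the Dirichlet problem -/

namespace CalcGraph

variable {V E : Type*} (G : CalcGraph V E)

open Classical in
/-- The coefficient `𝒱(v)⁻¹ a_e / ℓ_e` of the edge `e` in the Laplacian at the interior vertex `v`,
and `0` if `e` is a loop or not incident with `v`, or if `v` is a boundary vertex. -/
noncomputable def edgeRate (v : V) (e : E) : ℝ≥0∞ :=
  if v ∈ G.interiorV ∧ G.Incident e v ∧ ¬ G.IsLoop e then
    (ENNReal.ofReal (G.vol v))⁻¹ * ENNReal.ofReal (G.wt e / G.len e) else 0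

/-- The vertex at the other end of the edge `e`, seen from `v`. -/
noncomputable def nbr (v : V) (e : E) : V := G.other e v

variable {G}

theorem edgeRate_of_notMem {v : V} (hv : v ∉ G.interiorV) (e : E) : G.edgeRate v e = 0 :=
  if_neg fun h => hv h.1

theorem tsum_edgeRate {v : V} (hv : v ∈ G.interiorV) : ∑' e, G.edgeRate v e = G.L v := by
  rw [L, ← ENNReal.tsum_mul_left]
  refine (tsum_subtype_eq_of_support_subset (s := {e | G.Incident e v ∧ ¬ G.IsLoop e})
    fun e he => ?_).symm.trans ?_
  · by_contra h
    exact he (if_neg fun h' => h h'.2)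
  · exact tsum_congr fun e => if_pos ⟨hv, e.2⟩

theorem joins_other {e : E} {v : V} (h : G.Incident e v) : G.Joins e v (G.other e v) := by
  unfold other Joins
  rcases h with h | h
  · simp [h]
  · by_cases h' : G.src e = v <;> simp [h, h']

/-! ### Growth conditions and finiteness of the exponential majorant -/

theorem Lsup_mono (v : V) : Monotone fun j => G.Lsup j v := fun _ _ hij =>
  biSup_mono fun _ ⟨n, hn, h⟩ => ⟨n, hn.trans hij, h⟩

theorem L_le_Lsup_zero {v : V} (hv : v ∈ G.interiorV) : G.L v ≤ G.Lsup 0 v :=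
  le_biSup (fun u => G.L u) (i := v) ⟨0, le_rfl, .nil hv⟩

theorem Lsup_le_Lsup_succ {e : E} {v w : V} (hv : v ∈ G.interiorV) (he : G.Joins e v w) (j : ℕ) :
    G.Lsup j w ≤ G.Lsup (j + 1) v :=
  biSup_mono fun _ ⟨n, hn, h⟩ => ⟨n + 1, Nat.succ_le_succ hn, .cons hv e he h⟩

theorem iterate_majorantOp_one_of_notMem {v : V} (hv : v ∉ G.interiorV) (n : ℕ) :
    (majorantOp G.edgeRate G.nbr)^[n + 1] 1 v = 0 := by
  rw [Function.iterate_succ_apply']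
  simp [majorantOp, edgeRate_of_notMem hv]

/-- One application of `P` contributes `L v ≤ L_0(v)` times two values of the previous iterate. At
an interior neighbour `w` one has `L_i(w) ≤ L_{i+1}(v)`, so the product shifts by one index. -/
theorem iterate_majorantOp_one_le {v : V} (hv : v ∈ G.interiorV) (n : ℕ) :
    (majorantOp G.edgeRate G.nbr)^[n] 1 v ≤ 2 ^ n * ∏ i ∈ Finset.range n, G.Lsup i v := by
  induction n generalizing v with
  | zero => simp
  | succ n ih =>
    rw [Function.iterate_succ_apply']
    set X : ℝ≥0∞ := 2 ^ n * ∏ i ∈ Finset.range n, G.Lsup (i + 1) v with hX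
    have h1 : (majorantOp G.edgeRate G.nbr)^[n] 1 v ≤ X := by
      refine (ih hv).trans ?_
      rw [hX]
      gcongr with i
      exact Lsup_mono v (Nat.le_succ i)
    have h2 : ∀ e, G.Incident e v → (majorantOp G.edgeRate G.nbr)^[n] 1 (G.nbr v e) ≤ X := by
      intro e he
      by_cases hw : G.nbr v e ∈ G.interiorV
      · refine (ih hw).trans ?_
        rw [hX]
        gcongr with i
        exact Lsup_le_Lsup_succ hv (joins_other he) i
      -- At a boundary neighbour the iterate is `1` for `n = 0`, where `X = 1`, and `0` afterwards.
      · rcases n with _ | n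
        · simp [hX]
        · rw [iterate_majorantOp_one_of_notMem hw]; exact zero_le
    calc majorantOp G.edgeRate G.nbr ((majorantOp G.edgeRate G.nbr)^[n] 1) v
        ≤ ∑' e, G.edgeRate v e * (X + X) := by
          refine ENNReal.tsum_le_tsum fun e => ?_
          by_cases he : G.Incident e v
          · gcongr
            exact h2 e he
          · rw [show G.edgeRate v e = 0 from if_neg fun h => he h.2.1]; simp
      _ = G.L v * (X + X) := by rw [ENNReal.tsum_mul_right, tsum_edgeRate hv]
      _ ≤ G.Lsup 0 v * (X + X) := by gcongr; exact L_le_Lsup_zero hv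
      _ = _ := by rw [Finset.prod_range_succ', hX]; ring

/-- Since `0 * ∞ = 0`, a vanishing last factor could hide an infinite product. But `L_j` increases
with `j`, so all earlier factors would then vanish as well. -/
theorem prod_Lsup_ne_top_of_succ {v : V} {n : ℕ}
    (h : ∏ i ∈ Finset.range (n + 1), G.Lsup i v ≠ ∞) :
    ∏ i ∈ Finset.range n, G.Lsup i v ≠ ∞ := by
  intro htop
  rw [Finset.prod_range_succ, htop] at h
  have h0 : G.Lsup n v = 0 := by
    by_contra h0
    exact h (ENNReal.top_mul h0)
  rcases n with _ | n
  · simp at htop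
  · have : G.Lsup 0 v = 0 := le_antisymm ((Lsup_mono v (Nat.zero_le _)).trans h0.le) zero_le
    rw [Finset.prod_eq_zero (Finset.mem_range.2 n.succ_pos) this] at htop
    exact ENNReal.zero_ne_top htop

theorem prod_Lsup_ne_top {v : V} {D K : ℝ≥0} {j₀ : ℕ}
    (h : ∀ n ≥ j₀, ∏ i ∈ Finset.range n, G.Lsup i v ≤ K * (D ^ n * n.factorial : ℝ≥0)) (n : ℕ) :
    ∏ i ∈ Finset.range n, G.Lsup i v ≠ ∞ := by
  have key : ∀ k, ∏ i ∈ Finset.range (n + k), G.Lsup i v ≠ ∞ →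
      ∏ i ∈ Finset.range n, G.Lsup i v ≠ ∞ := by
    intro k
    induction k with
    | zero => exact id
    | succ k ih => exact fun hk => ih (prod_Lsup_ne_top_of_succ hk)
  refine key j₀ (ne_top_of_le_ne_top ?_ (h (n + j₀) (Nat.le_add_left _ _)))
  exact ENNReal.mul_ne_top ENNReal.coe_ne_top ENNReal.coe_ne_top

theorem exists_prod_Lsup_le
    (hL : (∃ C : ℝ≥0, ∀ v ∈ G.interiorV, ∀ᶠ j : ℕ in Filter.atTop,
            G.Lsup j v ≤ (C : ℝ≥0∞) * (j : ℝ≥0∞)) ∨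
          (∃ C : ℝ≥0, ∀ v ∈ G.interiorV, ∀ᶠ j : ℕ in Filter.atTop,
            ∏ i ∈ Finset.range (j + 1), G.Lsup i v ≤ ((C : ℝ≥0∞) * (j : ℝ≥0∞)) ^ j)) :
    ∃ D : ℝ≥0, 0 < D ∧ ∀ v ∈ G.interiorV, ∃ K : ℝ≥0, ∃ j₀ : ℕ, ∀ n ≥ j₀,
      ∏ i ∈ Finset.range n, G.Lsup i v ≤ K * (D ^ n * n.factorial : ℝ≥0) := by
  rcases hL with ⟨C, hC⟩ | ⟨C, hC⟩
  · refine ⟨C + 1, by positivity, fun v hv => ?_⟩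
    obtain ⟨j₀, hj₀⟩ := Filter.eventually_atTop.1 (hC v hv)
    have hfin : ∏ i ∈ Finset.range j₀, G.Lsup i v ≠ ∞ := by
      refine ENNReal.prod_ne_top fun i hi => ne_top_of_le_ne_top ?_
        ((Lsup_mono v (Finset.mem_range.1 hi).le).trans (hj₀ j₀ le_rfl))
      exact ENNReal.mul_ne_top ENNReal.coe_ne_top (ENNReal.natCast_ne_top _)
    refine ⟨(∏ i ∈ Finset.range j₀, G.Lsup i v).toNNReal, j₀, fun n hn => ?_⟩
    rw [ENNReal.coe_toNNReal hfin]
    induction n, hn using Nat.le_induction with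
    | base =>
      refine le_mul_of_one_le_right zero_le ?_
      have h1 : (1 : ℝ≥0) ≤ (C + 1) ^ j₀ := one_le_pow₀ (by simp)
      have h2 : (1 : ℝ≥0) ≤ j₀.factorial := by exact_mod_cast j₀.factorial_pos
      exact_mod_cast one_le_mul h1 h2
    | succ n hn ih =>
      rw [Finset.prod_range_succ]
      calc _ ≤ (∏ i ∈ Finset.range j₀, G.Lsup i v) * ((C + 1) ^ n * n.factorial : ℝ≥0) *
            (((C + 1) * (n + 1) : ℝ≥0) : ℝ≥0∞) := by
              refine mul_le_mul' ih ((hj₀ n hn).trans ?_)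
              have : C * n ≤ (C + 1) * (n + 1) := by gcongr <;> simp
              exact_mod_cast this
        _ = _ := by
          rw [mul_assoc, ← ENNReal.coe_mul, Nat.factorial_succ]
          congr 2
          push_cast
          ring
  -- The `3` comes from `m ^ m ≤ e ^ m * m! ≤ 3 ^ m * m!`. The `+ 1` makes the base at least `1`,
  -- which absorbs the difference between `m + 1` factors and exponent `m`.
  · refine ⟨3 * C + 1, by positivity, fun v hv => ?_⟩
    obtain ⟨j₀, hj₀⟩ := Filter.eventually_atTop.1 (hC v hv)
    refine ⟨1, j₀ + 1, fun n hn => ?_⟩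
    obtain ⟨j, rfl⟩ := Nat.exists_eq_add_of_le' hn
    refine (hj₀ (j + j₀) (Nat.le_add_left _ _)).trans ?_
    rw [← add_assoc]
    generalize j + j₀ = m
    have h1 : ((m : ℝ≥0)) ^ m ≤ 3 ^ m * m.factorial := by
      have h2 := Real.pow_div_factorial_le_exp (m : ℝ) (Nat.cast_nonneg m) m
      rw [div_le_iff₀ (by positivity)] at h2
      have h3 : Real.exp m ≤ 3 ^ m := by
        rw [← mul_one (m : ℝ), Real.exp_nat_mul]
        gcongr
        exact Real.exp_one_lt_three.le
      have h4 : (m : ℝ) ^ m ≤ 3 ^ m * m.factorial :=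
        h2.trans (mul_le_mul_of_nonneg_right h3 (by positivity))
      exact_mod_cast h4
    have h5 : (C * m) ^ m ≤ (3 * C + 1) ^ (m + 1) * (m + 1).factorial :=
      calc (C * m) ^ m = C ^ m * (m : ℝ≥0) ^ m := mul_pow _ _ _
        _ ≤ C ^ m * (3 ^ m * m.factorial) := by gcongr
        _ = (3 * C) ^ m * m.factorial := by rw [mul_pow]; ring
        _ ≤ (3 * C + 1) ^ m * m.factorial := by gcongr; simp
        _ ≤ (3 * C + 1) ^ (m + 1) * (m + 1).factorial := by
          gcongr <;> simp
    rw [ENNReal.coe_one, one_mul]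
    exact_mod_cast h5

theorem exists_expMajorant_ne_top
    (hL : (∃ C : ℝ≥0, ∀ v ∈ G.interiorV, ∀ᶠ j : ℕ in Filter.atTop,
            G.Lsup j v ≤ (C : ℝ≥0∞) * (j : ℝ≥0∞)) ∨
          (∃ C : ℝ≥0, ∀ v ∈ G.interiorV, ∀ᶠ j : ℕ in Filter.atTop,
            ∏ i ∈ Finset.range (j + 1), G.Lsup i v ≤ ((C : ℝ≥0∞) * (j : ℝ≥0∞)) ^ j)) :
    ∃ τ : ℝ≥0, 0 < τ ∧ ∀ v, expMajorant G.edgeRate G.nbr (τ + τ) v ≠ ∞ := by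
  obtain ⟨D, hD, h⟩ := exists_prod_Lsup_le hL
  -- Then `2τ = 1 / (4D)`, and from index `j₀` on the series is dominated by `(4D)⁻ᵐ / m! · 2ᵐ · K
  -- Dᵐ m! = K 2⁻ᵐ`. Only `K` and `j₀` depend on `v`.
  refine ⟨(8 * D)⁻¹, by positivity, fun v => ?_⟩
  have hτ : (8 * D)⁻¹ + (8 * D)⁻¹ = (4 * D)⁻¹ := by
    rw [← NNReal.coe_inj]; push_cast; field_simp; norm_num
  rw [hτ]
  have hsplit : ∀ k, (∀ n, (majorantOp G.edgeRate G.nbr)^[n] 1 v ≠ ∞) →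
      ∑' n, (expCoeff (4 * D)⁻¹ (n + k) : ℝ≥0∞) * (majorantOp G.edgeRate G.nbr)^[n + k] 1 v ≠ ∞ →
      expMajorant G.edgeRate G.nbr (4 * D)⁻¹ v ≠ ∞ := by
    intro k h1 h2
    rw [expMajorant, ← ENNReal.summable.sum_add_tsum_nat_add' (k := k)]
    exact ENNReal.add_ne_top.2
      ⟨ENNReal.sum_ne_top.2 fun n _ => ENNReal.mul_ne_top ENNReal.coe_ne_top (h1 n), h2⟩
  by_cases hv : v ∈ G.interiorV
  · obtain ⟨K, j₀, hK⟩ := h v hv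
    refine hsplit j₀ (fun n => ne_top_of_le_ne_top (ENNReal.mul_ne_top (by simp)
      (prod_Lsup_ne_top hK n)) (iterate_majorantOp_one_le hv n)) ?_
    have hgeom : ∑' n : ℕ, (K : ℝ≥0∞) * (2⁻¹ : ℝ≥0∞) ^ n ≠ ∞ := by
      rw [ENNReal.tsum_mul_left, ENNReal.tsum_geometric, ENNReal.one_sub_inv_two, inv_inv]
      exact ENNReal.mul_ne_top ENNReal.coe_ne_top ENNReal.ofNat_ne_top
    refine ne_top_of_le_ne_top hgeom ?_
    refine le_trans (ENNReal.tsum_le_tsum fun n => ?_)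
      (ENNReal.tsum_comp_le_tsum_of_injective (add_left_injective j₀)
        (fun n => (K : ℝ≥0∞) * (2⁻¹ : ℝ≥0∞) ^ n))
    generalize hm : n + j₀ = m
    calc (expCoeff (4 * D)⁻¹ m : ℝ≥0∞) * (majorantOp G.edgeRate G.nbr)^[m] 1 v
        ≤ (expCoeff (4 * D)⁻¹ m : ℝ≥0∞) * (2 ^ m * (K * (D ^ m * m.factorial : ℝ≥0))) := by
          gcongr
          exact (iterate_majorantOp_one_le hv m).trans (by gcongr; exact hK m (by omega))
      _ = ((expCoeff (4 * D)⁻¹ m * (2 ^ m * (K * (D ^ m * m.factorial))) : ℝ≥0) : ℝ≥0∞) := by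
          push_cast; rfl
      _ = ((K * 2⁻¹ ^ m : ℝ≥0) : ℝ≥0∞) := by
          congr 1
          unfold expCoeff
          have : (m.factorial : ℝ≥0) ≠ 0 := by positivity
          have h4 : (4 : ℝ≥0) ^ m = 2 ^ m * 2 ^ m := by rw [← mul_pow]; norm_num
          rw [inv_pow, inv_pow, mul_pow, h4]
          field_simp
      _ = _ := by simp [ENNReal.inv_pow]
  · refine hsplit 1 (fun n => ?_) ?_
    · rcases n with _ | n
      · simp
      · rw [iterate_majorantOp_one_of_notMem hv]; exact ENNReal.zero_ne_top
    · simp [iterate_majorantOp_one_of_notMem hv]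

/-! ### The time interval -/

theorem isClosed_timeInterval (T : EReal) : IsClosed (timeInterval T) :=
  (isClosed_Ici (a := (0 : ℝ))).inter (isClosed_Iic.preimage continuous_coe_real_ereal)

theorem ordConnected_timeInterval (T : EReal) : (timeInterval T).OrdConnected :=
  ⟨fun _ ha _ hb _ hc => ⟨ha.1.trans hc.1, (EReal.coe_le_coe_iff.2 hc.2).trans hb.2⟩⟩

theorem interior_timeInterval_subset (T : EReal) :
    interior (timeInterval T) ⊆ {t : ℝ | 0 < t ∧ (t : EReal) < T} := by
  intro t ht
  obtain ⟨ε, hε, hball⟩ := Metric.isOpen_iff.1 isOpen_interior t ht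
  have h1 := interior_subset (hball (show t - ε / 2 ∈ Metric.ball t ε by
    rw [Metric.mem_ball, Real.dist_eq, abs_lt]; constructor <;> linarith))
  have h2 := interior_subset (hball (show t + ε / 2 ∈ Metric.ball t ε by
    rw [Metric.mem_ball, Real.dist_eq, abs_lt]; constructor <;> linarith))
  exact ⟨by linarith [h1.1], (EReal.coe_lt_coe_iff.2 (by linarith)).trans_le h2.2⟩

/-! ### The difference of two solutions -/

theorem HasLaplacianAt.sub {f g : G.Point → ℝ} {v : V} {d d' : ℝ} (h : G.HasLaplacianAt f v d)
    (h' : G.HasLaplacianAt g v d') : G.HasLaplacianAt (fun x => f x - g x) v (d - d') := by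
  obtain ⟨S, hS, rfl⟩ := h
  obtain ⟨S', hS', rfl⟩ := h'
  refine ⟨S - S', (hS.sub hS').congr_fun ?_, by ring⟩
  intro e
  ring

theorem HasLaplacianAt.enorm_le {f : G.Point → ℝ} {v : V} {d : ℝ} (hv : v ∈ G.interiorV)
    (h : G.HasLaplacianAt f v d) :
    ‖d‖ₑ ≤ majorantOp G.edgeRate G.nbr (fun w => ‖f (.vertex w)‖ₑ) v := by
  obtain ⟨S, hS, rfl⟩ := h
  have hvol := G.vol_pos v
  have hinv : ‖(G.vol v)⁻¹‖ₑ = (ENNReal.ofReal (G.vol v))⁻¹ := by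
    rw [Real.enorm_eq_ofReal_abs, abs_of_pos (inv_pos.2 hvol), ENNReal.ofReal_inv_of_pos hvol]
  rw [enorm_mul, ← hS.tsum_eq, hinv]
  calc _ ≤ (ENNReal.ofReal (G.vol v))⁻¹ * ∑' e : {e // G.Incident e v},
        ‖G.wt e * ((f (.vertex v) - f (.vertex (G.other e v))) / G.len e)‖ₑ := by
        gcongr
        exact enorm_tsum_le_tsum_enorm
    _ ≤ ∑' e : {e // G.Incident e v}, G.edgeRate v e *
        (‖f (.vertex (G.nbr v e))‖ₑ + ‖f (.vertex v)‖ₑ) := by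
        rw [← ENNReal.tsum_mul_left]
        refine ENNReal.tsum_le_tsum fun ⟨e, he⟩ => ?_
        -- A loop contributes a zero difference to the Laplacian, in agreement with its omission
        -- from `L`.
        by_cases hl : G.IsLoop e
        · have : G.other e v = v := by
            rcases joins_other he with h | h
            · rw [← h.2, ← hl, h.1]
            · rw [← h.1, hl, h.2]
          simp [this]
        · have hr : G.edgeRate v e = (ENNReal.ofReal (G.vol v))⁻¹ *
              ENNReal.ofReal (G.wt e / G.len e) := if_pos ⟨hv, he, hl⟩
          have hwl : 0 < G.wt e / G.len e := div_pos (G.wt_pos e) (G.len_pos e)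
          rw [hr, mul_assoc, ← mul_div_assoc, mul_div_right_comm, enorm_mul,
            Real.enorm_of_nonneg hwl.le, add_comm]
          gcongr
          exact enorm_sub_le
    _ ≤ _ := ENNReal.tsum_comp_le_tsum_of_injective Subtype.val_injective
        (fun e => G.edgeRate v e * (‖f (.vertex (G.nbr v e))‖ₑ + ‖f (.vertex v)‖ₑ))

theorem IsHeatSolution.continuousOn_vertex {T : EReal} {u : G.Point → ℝ → ℝ}
    (h : G.IsHeatSolution T u) (v : V) : ContinuousOn (u (.vertex v)) (timeInterval T) :=
  h.continuousOn.comp (f := fun t => ((.vertex v, t) : G.Point × ℝ)) (by fun_prop)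
    fun _ ht => ⟨Set.mem_univ _, ht⟩

theorem heatInequality_sub {T : EReal} {f : G.interiorV → ℝ} {u₁ u₂ : G.Point → ℝ → ℝ}
    (h₁ : G.IsDirichletSolution T f u₁) (b₁ : G.BoundedInSpace T u₁)
    (h₂ : G.IsDirichletSolution T f u₂) (b₂ : G.BoundedInSpace T u₂) :
    HeatInequality G.edgeRate G.nbr (timeInterval T)
      (fun v t => u₁ (.vertex v) t - u₂ (.vertex v) t) where
  continuousOn v := (h₁.continuousOn_vertex v).sub (h₂.continuousOn_vertex v)
  deriv v t ht := by
    obtain ⟨ht0, htT⟩ := interior_timeInterval_subset T ht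
    by_cases hv : v ∈ G.interiorV
    · obtain ⟨d₁, l₁, k₁⟩ := h₁.heat v hv t ht0 htT
      obtain ⟨d₂, l₂, k₂⟩ := h₂.heat v hv t ht0 htT
      refine ⟨-(d₁ - d₂), (k₁.sub k₂).congr_deriv (by ring), ?_⟩
      rw [enorm_neg]
      exact (l₁.sub l₂).enorm_le hv
    · have hv' : v ∈ G.boundary := not_not.1 hv
      refine ⟨0, (hasDerivAt_const t (0 : ℝ)).congr_of_eventuallyEq ?_, by simp⟩
      filter_upwards [isOpen_interior.mem_nhds ht] with s hs
      rw [h₁.dirichlet v hv' s (interior_subset hs), h₂.dirichlet v hv' s (interior_subset hs),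
        sub_zero]
  bounded t ht := by
    obtain ⟨B₁, hB₁⟩ := b₁ t ht
    obtain ⟨B₂, hB₂⟩ := b₂ t ht
    refine ⟨(B₁ + B₂).toNNReal, fun v => ?_⟩
    rw [Real.enorm_eq_ofReal_abs]
    exact ENNReal.ofReal_le_ofReal ((abs_sub _ _).trans (add_le_add (hB₁ _) (hB₂ _)))

/-! ### Existence -/

theorem abs_interp_le_of_bounded {g : V → ℝ} {M : ℝ} (hM : ∀ v, |g v| ≤ M) (p : G.Point) :
    |G.interp g p| ≤ M := (abs_interp_le hM p).trans_eq (interp_const M p)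

theorem exists_isDirichletSolution (hG : G.LocallyFinite) (T : EReal) {f : G.interiorV → ℝ}
    (hf : ∃ M : ℝ, ∀ v, |f v| ≤ M) :
    ∃ u : G.Point → ℝ → ℝ, G.IsDirichletSolution T f u ∧ G.BoundedInSpace T u := by
  classical
  obtain ⟨M, hM⟩ := hf
  -- The edge set is taken empty at boundary vertices and the initial value `0` there, so the
  -- solution stays `0` at them.
  obtain ⟨w, h1, h2, h3, h4, h5⟩ := exists_heat_solution
    (s := fun v => if v ∈ G.interiorV then (hG v).toFinset else ∅)
    (c := fun v e => (G.vol v)⁻¹ * (G.wt e / G.len e)) (nbr := G.nbr)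
    (fun v e => mul_nonneg (inv_nonneg.2 (G.vol_pos v).le)
      (div_nonneg (G.wt_pos e).le (G.len_pos e).le))
    (f := fun v => if h : v ∈ G.interiorV then f ⟨v, h⟩ else 0) (M := max M 0) (fun v => by
      split_ifs with h
      · exact (hM _).trans (le_max_left _ _)
      · rw [abs_zero]; exact le_max_right _ _)
  refine ⟨fun p t => G.interp (fun v => w v t) p, ⟨⟨(continuous_interp hG h1 h2).continuousOn,
    fun t _ => edgewiseLinear_interp hG fun v => h2 v t, fun v hv t ht _ => ?_⟩, fun v => ?_,
    fun v hv t _ => ?_⟩, fun t _ => ⟨max M 0, abs_interp_le_of_bounded fun v => h2 v t⟩⟩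
  · have : Fintype {e // G.Incident e v} := (hG v).fintype
    refine ⟨_, ⟨_, hasSum_fintype _, rfl⟩, (h5 v t ht).congr_deriv ?_⟩
    rw [if_pos hv, Finset.sum_subtype _ (p := fun e => G.Incident e v) (by simp), Finset.mul_sum,
      ← Finset.sum_neg_distrib]
    refine Finset.sum_congr rfl fun e _ => ?_
    simp only [interp, nbr]
    ring
  · exact (h3 v).trans (dif_pos v.2)
  · have hv' : v ∉ G.interiorV := fun h => h hv
    exact (h4 v (if_neg hv') t).trans (dif_neg hv')

end CalcGraph

theorem mainTheorem12 {V E : Type*} (G : CalcGraph V E)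
    (hL : (∃ C : ℝ≥0, ∀ v ∈ G.interiorV, ∀ᶠ j : ℕ in Filter.atTop,
            G.Lsup j v ≤ (C : ℝ≥0∞) * (j : ℝ≥0∞)) ∨
          (∃ C : ℝ≥0, ∀ v ∈ G.interiorV, ∀ᶠ j : ℕ in Filter.atTop,
            ∏ i ∈ Finset.range (j + 1), G.Lsup i v ≤ ((C : ℝ≥0∞) * (j : ℝ≥0∞)) ^ j))
    (T : EReal) (hT : 0 < T) :
    (∀ (f : G.interiorV → ℝ) (u₁ u₂ : G.Point → ℝ → ℝ),
      G.IsDirichletSolution T f u₁ → G.BoundedInSpace T u₁ →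
      G.IsDirichletSolution T f u₂ → G.BoundedInSpace T u₂ →
      ∀ x, ∀ t ∈ CalcGraph.timeInterval T, u₁ x t = u₂ x t) ∧
    (G.LocallyFinite → ∀ f : G.interiorV → ℝ, (∃ M : ℝ, ∀ v, |f v| ≤ M) →
      ∃ u : G.Point → ℝ → ℝ, G.IsDirichletSolution T f u ∧ G.BoundedInSpace T u) := by
  refine ⟨fun f u₁ u₂ h₁ b₁ h₂ b₂ x t ht => ?_,
    fun hG f hf => CalcGraph.exists_isDirichletSolution hG T hf⟩
  obtain ⟨τ, hτ, hfin⟩ := CalcGraph.exists_expMajorant_ne_top hL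
  have h0 : (0 : ℝ) ∈ CalcGraph.timeInterval T := ⟨le_rfl, by exact_mod_cast hT.le⟩
  have key : ∀ v, u₁ (.vertex v) t = u₂ (.vertex v) t := fun v => sub_eq_zero.1 <|
    (CalcGraph.heatInequality_sub h₁ b₁ h₂ b₂).eq_zero (CalcGraph.isClosed_timeInterval T)
      (CalcGraph.ordConnected_timeInterval T) hτ hfin h0 (fun v => by
        by_cases hv : v ∈ G.interiorV
        · rw [h₁.initial ⟨v, hv⟩, h₂.initial ⟨v, hv⟩, sub_self]
        · rw [h₁.dirichlet v (not_not.1 hv) 0 h0, h₂.dirichlet v (not_not.1 hv) 0 h0, sub_self])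
      ht ht.1 v
  -- Equality at the vertices suffices, as edgewise linear functions are determined by their vertex
  -- values.
  rw [(h₁.edgewiseLinear t ht).eq_interp x, (h₂.edgewiseLinear t ht).eq_interp x]
  simp only [key]
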